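/- **Setting.** Let $p$ be a prime and $F=\mathbb Z/p$. Let $\mathcal Q,\mathcal Z$ be finite sets, and for every state $q\in\mathcal Q$ let $W_q(z|x)$ be a channel from $F$ to $\mathcal Z$. Assume every $W_q$ is *symmetric*: the outputs can be partitioned so that in the submatrix of $W_q$ induced by each part all rows are permutations of each other and all columns are permutations of each other (strongly symmetric = a single part). For block length $n$ and a type $t=(t_q)_q$ of nonnegative integers with $\sum_q t_q=n$, the adversary picks any state sequence $w\in\mathcal Q^n$ in which each $q$ occurs exactly $t_q=nf_q$ times, and sees the output of $\prod_i W_{w_i}(z_i|x_i)$. All logarithms are to base $2$; $I_q(X;Z)$ is the mutual information of $W_q$ for uniform input. A *two-universal hash with inverter* on $\mathcal V$ consists of finite nonempty sets $\mathcal M,\mathcal S,\mathcal R$ and maps $\mathrm{Ext}:\mathcal V\times\mathcal S\to\mathcal M$, $\mathrm{Inv}:\mathcal M\times\mathcal S\times\mathcal R\to\mathcal V$ with $\Pr_S[\mathrm{Ext}(v,S)=\mathrm{Ext}(v',S)]\le 1/|\mathcal M|$ for $v\ne v'$ ($S$ uniform), and $\mathrm{Inv}(m,s,R)$ uniform on $\{v:\mathrm{Ext}(v,s)=m\}$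 for all $m,s$ ($R$ uniform). *Protocol 1* with an injective linear encoder $\mathrm{ECC}:\mathcal V=F^k\to F^n$ and a decoder $\mathrm{DEC}$ sends $\mathrm{ECC}(\mathrm{Inv}(m,s,r))$, where $s$ is a uniform public seed (known to everyone) and $r$ is uniform; the receiver outputs $\mathrm{Ext}(\mathrm{DEC}(y),s)$. Let $Z(m)$ be the eavesdropper's output for message $m$. A scheme is *$\varepsilon$-secret for arbitrary messages* if for every allowed $w$ and all $m,m'$ the variational distance of $(Z(m),S)$ and $(Z(m'),S)$ is at most $\varepsilon$; it is *$\varepsilon$-secret for random messages* if for every allowed $w$ and uniform $M$ the joint law of $(M,S,Z)$ has variational distance at most $\varepsilon$ from the product of the uniform law on $\mathcal M$ and the law of $(S,Z)$. It is *$\varepsilon$-correct* if each message is decoded wrongly with probability at most $\varepsilon$. **Theorem.** 1. For all $\delta,\varepsilon>0$ there is $n_0$ (depending only on $p,W,\delta,\varepsilon$) such that for all $n\ge n_0$, all types $t$ with $\sum_q t_q=n$, $f_q=t_q/n$, all injective linear encoders $\mathrm{ECC}:\mathcal V=F^k\to F^n$, and all two-universal hashes with inverter on $\mathcal V$ satisfying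 $$\log|\mathcal M|\le \log|\mathcal V|-n\sum_q f_qI_q(X;Z)-n\delta ,$$ Protocol 1 is $\varepsilon$-secret for random messages. It is moreover $\varepsilon$-secret for arbitrary messages if all functions $\mathrm{Ext}(\cdot,s)$ are $F$-linear (for some $F$-vector space structure on $\mathcal M$; this holds for linear inverters) and in addition either $p\le 3$, or for every $q$ and every $a\in F$ there is a permutation $\pi$ of $\mathcal Z$ with $W_q(\pi(z)|x+a)=W_q(z|x)$ for all $x,z$. 2. Let $n_j\to\infty$ be block lengths with types $t^{(j)}$, $\sum_q t^{(j)}_q=n_j$, $t^{(j)}_q/n_j\to f_q$, and let $\mathrm{ECC}_j:\mathcal V_j=F^{k_j}\to F^{n_j}$ be any injective linear encoders. The only symmetry assumed here is that each $W_q$ is symmetric. (a) There are two-universal hashes with inverter on $\mathcal V_j$ for which Protocol 1 is $\varepsilon_j$-secret for arbitrary messages with $\varepsilon_j\to0$, and whose message length reaches the bound: $$\frac1{n_j}\Big(\log|\mathcal M_j|-\max\big\{0,\ \log|\mathcal V_j|-n_j\sum_q f_qI_q(X;Z)\big\}\Big)\to0 .$$ (b) Let the receiver's channel be $n_j$ uses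 of a discrete memoryless channel $W_R:F\to\mathcal Y$, with $\mathcal Y$ finite, of Shannon capacity $C_R=\max_{P_X}I(X;Y)$. Suppose that the code achieves capacity, i.e. $\frac1{n_j}\log|\mathcal V_j|\to C_R$ and for suitable decoders the error probability averaged over the codewords tends to $0$. Suppose also that uniform input is optimal, i.e. for all finite $A$ and all $P_{AX}$ (with $A$ and the outputs conditionally independent given $X$), $I(A;Y)-\sum_qf_qI_q(A;Z)$ is at most its value for $A=X$ uniform. Then there are two-universal hashes with inverter for which Protocol 1 is $\varepsilon_j$-correct and $\varepsilon_j$-secret for arbitrary messages with $\varepsilon_j\to0$ and has rate $\frac1{n_j}\log|\mathcal M_j|\to C_R-\sum_qf_qI_q(X;Z)$. This number is the secrecy capacity: it is the largest rate achievable by any sequence of schemes with a public uniform seed, stochastic encoder and decoder whose error and secrecy parameters (arbitrary messages, all allowed state sequences) tend to $0$ along $n_j$. In particular this holds for strongly symmetric $W_q$. -/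

import Mathlib

open Filter Topology
open scoped Classical

namespace Wiretap

noncomputable section

universe u v w

/-! ## Distributions, channels, entropy -/

/-- Probability distributions on a finite set. -/
abbrev Distr (α : Type u) [Fintype α] : Type u := stdSimplex ℝ α

/-- A (discrete) channel: `W x z` is the probability of the output `z` on the input `x`. -/
abbrev Channel (X : Type u) (Z : Type v) [Fintype Z] : Type (max u v) := X → Distr Z

/-- The output distribution of the channel `W` on an input distributed as `P`. -/
def output {X : Type u} {Z : Type v} [Fintype X] [Fintype Z] (P : Distr X) (W : Channel X Z) :
    Distr Z :=
  ⟨fun z => ∑ x, P x * W x z,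
    fun z => Finset.sum_nonneg fun x _ => mul_nonneg (P.2.1 x) ((W x).2.1 z), by
      rw [Finset.sum_comm]
      simp only [← Finset.mul_sum, stdSimplex.sum_eq_one, mul_one]⟩

/-- The channel that first applies `T` and then `W`. -/
def Channel.comp {A : Type u} {X : Type v} {Z : Type w} [Fintype X] [Fintype Z]
    (T : Channel A X) (W : Channel X Z) : Channel A Z :=
  fun a => output (T a) W

/-- Memoryless, not necessarily identical, product of the channels `W i`. -/
def prodChannel {n : ℕ} {X : Type u} {Z : Type v} [Fintype Z] (W : Fin n → Channel X Z) :
    Channel (Fin n → X) (Fin n → Z) :=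
  fun x => ⟨fun z => ∏ i, W i (x i) (z i),
    fun z => Finset.prod_nonneg fun i _ => (W i (x i)).2.1 (z i), by
      have h := Finset.prod_univ_sum (fun _ : Fin n => (Finset.univ : Finset Z))
        (fun i z => W i (x i) z)
      rw [Fintype.piFinset_univ] at h
      rw [← h]
      simp only [stdSimplex.sum_eq_one, Finset.prod_const_one]⟩

/-- Shannon entropy, in bits. -/
def entropy {α : Type u} [Fintype α] (P : Distr α) : ℝ := -∑ a, P a * Real.logb 2 (P a)

/-- Mutual information (in bits) `I(X;Z) = H(Z) - H(Z|X)` between the input of the channel `W`,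
distributed as `P`, and its output. -/
def mutualInfo {X : Type u} {Z : Type v} [Fintype X] [Fintype Z] (P : Distr X)
    (W : Channel X Z) : ℝ :=
  entropy (output P W) - ∑ x, P x * entropy (W x)

/-- The uniform distribution. -/
def uniform (α : Type u) [Fintype α] [Nonempty α] : Distr α := stdSimplex.barycenter

/-- Mutual information between uniform input and output. -/
def uniformInfo {X : Type u} {Z : Type v} [Fintype X] [Nonempty X] [Fintype Z]
    (W : Channel X Z) : ℝ :=
  mutualInfo (uniform X) W

/-- Shannon capacity of a discrete memoryless channel, `max_P I(X;Y)`. -/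
def shannonCapacity {X : Type u} {Y : Type v} [Fintype X] [Fintype Y] (W : Channel X Y) : ℝ :=
  ⨆ P : Distr X, mutualInfo P W

/-- Variational distance `½ ∑ |P - Q|`. -/
def variationalDistance {α : Type u} [Fintype α] (P Q : α → ℝ) : ℝ := 2⁻¹ * ∑ a, |P a - Q a|

/-! ## Symmetric channels -/

/-- The submatrix of the transition matrix with outputs in `A` is strongly symmetric: its rows
are permutations of each other, and so are its columns. -/
def IsStronglySymmetricOn {X : Type u} {Z : Type v} [Fintype Z] (W : Channel X Z) (A : Set Z) :
    Prop :=
  (∀ x x' : X, ∃ π : Equiv.Perm A, ∀ z : A, W x z = W x' (π z)) ∧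
  (∀ z z' : A, ∃ π : Equiv.Perm X, ∀ x : X, W x z = W (π x) z')

/-- A channel is symmetric if its outputs can be partitioned (into the classes of an equivalence
relation) such that every class induces a strongly symmetric submatrix. A strongly symmetric
channel is the case of a single class. -/
def IsSymmetric {X : Type u} {Z : Type v} [Fintype Z] (W : Channel X Z) : Prop :=
  ∃ r : Setoid Z, ∀ z₀ : Z, IsStronglySymmetricOn W {z | r z z₀}

/-- Every translation of the input can be undone by a permutation of the outputs. -/
def IsTranslationCovariant {X : Type u} {Z : Type v} [Add X] [Fintype Z] (W : Channel X Z) :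
    Prop :=
  ∀ a : X, ∃ π : Equiv.Perm Z, ∀ x z, W (x + a) (π z) = W x z

/-! ## Two-universal hashing with an inverter -/

/-- A two-universal family of hash functions `ext (·, s) : V → M`, `s ∈ S`, together with an
inverter: for all `m`, `s` and uniform `r ∈ R`, the value `inv m s r` is uniform over the
preimages of `m` under `ext (·, s)`. -/
structure InvertibleHash (V : Type) [Fintype V] : Type 1 where
  M : Type
  S : Type
  R : Type
  [fintypeM : Fintype M]
  [nonemptyM : Nonempty M]
  [fintypeS : Fintype S]
  [nonemptyS : Nonempty S]
  [fintypeR : Fintype R]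
  [nonemptyR : Nonempty R]
  ext : V → S → M
  inv : M → S → R → V
  two_universal : ∀ v₀ v₁ : V, v₀ ≠ v₁ →
    (Fintype.card {s : S // ext v₀ s = ext v₁ s} : ℝ) / Fintype.card S ≤ 1 / Fintype.card M
  inverter : ∀ (m : M) (s : S) (v : V),
    (Fintype.card {r : R // inv m s r = v} : ℝ) / Fintype.card R =
      if ext v s = m then 1 / (Fintype.card {v' : V // ext v' s = m} : ℝ) else 0

attribute [instance] InvertibleHash.fintypeM InvertibleHash.nonemptyM InvertibleHash.fintypeS
  InvertibleHash.nonemptyS InvertibleHash.fintypeR InvertibleHash.nonemptyR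

/-- All hash functions of the family are linear over the field `F`, for some `F`-vector space
structure on the message set. -/
def InvertibleHash.IsLinear (F : Type) [Field F] {V : Type} [Fintype V] [AddCommGroup V]
    [Module F V] (H : InvertibleHash V) : Prop :=
  ∃ (_ : AddCommGroup H.M) (_ : Module F H.M), ∀ s, IsLinearMap F fun v => H.ext v s

/-! ## Seeded wiretap schemes: encoding, correctness, secrecy -/

/-- The sender's part of a seeded wiretap scheme: a set `M` of messages, a set `S` of public
seeds, and a stochastic encoder. -/
structure SeededEncoder (n : ℕ) (X : Type) [Fintype X] : Type 1 where
  M : Type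
  S : Type
  [fintypeM : Fintype M]
  [nonemptyM : Nonempty M]
  [fintypeS : Fintype S]
  [nonemptyS : Nonempty S]
  enc : M → S → Distr (Fin n → X)

attribute [instance] SeededEncoder.fintypeM SeededEncoder.nonemptyM SeededEncoder.fintypeS
  SeededEncoder.nonemptyS

/-- The sender's side of the seeded wiretap protocol: for message `m`, seed `s` and uniform
randomness `r`, the codeword `ecc (inv m s r)` is sent. -/
def protocolEncoder {n : ℕ} {X : Type} [Fintype X] {V : Type} [Fintype V]
    (H : InvertibleHash V) (ecc : V → Fin n → X) : SeededEncoder n X where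
  M := H.M
  S := H.S
  enc := fun m s => stdSimplex.map (fun r => ecc (H.inv m s r)) (uniform H.R)

/-- The receiver's side of the seeded wiretap protocol: decode, then hash. -/
def protocolDecoder {n : ℕ} {X : Type} [Fintype X] {Y : Type u} {V : Type} [Fintype V]
    (H : InvertibleHash V) (ecc : V → Fin n → X) (dec : (Fin n → Y) → V) :
    (Fin n → Y) → (protocolEncoder H ecc).S → (protocolEncoder H ecc).M :=
  fun y (s : H.S) => H.ext (dec y) s

/-- The adversary's strategies: the state sequences in which every state `q` occurs exactly
`t q` times. -/
def stateSequences (n : ℕ) {Q : Type u} (t : Q → ℕ) : Set (Fin n → Q) :=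
  {w | ∀ q, Fintype.card {i : Fin n // w i = q} = t q}

/-- Distribution of the eavesdropper's output for the state sequence `w`, message `m`
and seed `s`. -/
def SeededEncoder.eavesdropper {n : ℕ} {X : Type} [Fintype X] {Q : Type u} {Z : Type v}
    [Fintype Z] (E : SeededEncoder n X) (W : Q → Channel X Z) (w : Fin n → Q) (m : E.M)
    (s : E.S) : Distr (Fin n → Z) :=
  output (E.enc m s) (prodChannel fun i => W (w i))

/-- `ε`-secrecy for arbitrary messages: for every state sequence and any two messages, the joint
distributions of (seed, eavesdropper's output) are `ε`-close. -/
def SeededEncoder.IsSecret {n : ℕ} {X : Type} [Fintype X] {Q : Type u} {Z : Type v} [Fintype Z]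
    (E : SeededEncoder n X) (W : Q → Channel X Z) (t : Q → ℕ) (ε : ℝ) : Prop :=
  ∀ w ∈ stateSequences n t, ∀ m m' : E.M,
    variationalDistance
      (fun a : E.S × (Fin n → Z) => 1 / (Fintype.card E.S : ℝ) * E.eavesdropper W w m a.1 a.2)
      (fun a : E.S × (Fin n → Z) => 1 / (Fintype.card E.S : ℝ) * E.eavesdropper W w m' a.1 a.2)
      ≤ ε

/-- `ε`-secrecy for random messages: for every state sequence and a uniform message, the joint
distribution of (message, seed, eavesdropper's output) is `ε`-close to the product of the uniform
distribution and the marginal distribution of (seed, eavesdropper's output). -/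
def SeededEncoder.IsSecretForRandomMessages {n : ℕ} {X : Type} [Fintype X] {Q : Type u}
    {Z : Type v} [Fintype Z] (E : SeededEncoder n X) (W : Q → Channel X Z) (t : Q → ℕ)
    (ε : ℝ) : Prop :=
  ∀ w ∈ stateSequences n t,
    variationalDistance
      (fun a : E.M × E.S × (Fin n → Z) =>
        1 / (Fintype.card E.M : ℝ) *
          (1 / (Fintype.card E.S : ℝ) * E.eavesdropper W w a.1 a.2.1 a.2.2))
      (fun a : E.M × E.S × (Fin n → Z) =>
        1 / (Fintype.card E.M : ℝ) * ∑ m' : E.M, 1 / (Fintype.card E.M : ℝ) *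
          (1 / (Fintype.card E.S : ℝ) * E.eavesdropper W w m' a.2.1 a.2.2))
      ≤ ε

/-- `ε`-correctness for arbitrary messages over `n` uses of the receiver's memoryless channel:
for every message, the probability (over a uniform seed, the encoder and the channel) that the
receiver's output differs from the message is at most `ε`. -/
def SeededEncoder.IsCorrect {n : ℕ} {X : Type} [Fintype X] {Y : Type u} [Fintype Y]
    (E : SeededEncoder n X) (dec : (Fin n → Y) → E.S → E.M) (WR : Channel X Y) (ε : ℝ) : Prop :=
  ∀ m : E.M, ∑ s : E.S, 1 / (Fintype.card E.S : ℝ) *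
    ∑ y : Fin n → Y, output (E.enc m s) (prodChannel fun _ => WR) y *
      (if dec y s ≠ m then 1 else 0) ≤ ε

/-- Probability of a decoding error of an error-correcting code for a uniform codeword. -/
def codeError {n : ℕ} {X : Type} {Y : Type u} [Fintype Y] {V : Type} [Fintype V]
    (ecc : V → Fin n → X) (dec : (Fin n → Y) → V) (WR : Channel X Y) : ℝ :=
  ∑ v, 1 / (Fintype.card V : ℝ) *
    ∑ y : Fin n → Y, prodChannel (fun _ => WR) (ecc v) y * (if dec y ≠ v then 1 else 0)

/-! ## Secrecy capacity -/

/-- `r` is an achievable secrecy rate of the arbitrarily varying wiretap channel with receiver's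
channel `WR` and eavesdropper's channels `W q`, along block lengths `n j` and state types `t j`:
some sequence of seeded wiretap schemes has error and secrecy parameter tending to zero (for
arbitrary messages and all state sequences of the given type) and asymptotic rate at
least `r` bits per channel use. -/
def IsAchievableSecrecyRate {X : Type} [Fintype X] {Y : Type u} [Fintype Y] {Q : Type v}
    {Z : Type w} [Fintype Z] (WR : Channel X Y) (W : Q → Channel X Z) (n : ℕ → ℕ)
    (t : ℕ → Q → ℕ) (r : ℝ) : Prop :=
  ∃ (E : ∀ j, SeededEncoder (n j) X) (dec : ∀ j, (Fin (n j) → Y) → (E j).S → (E j).M)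
    (ε : ℕ → ℝ), Tendsto ε atTop (𝓝 0) ∧
    (∀ j, (E j).IsCorrect (dec j) WR (ε j) ∧ (E j).IsSecret W (t j) (ε j)) ∧
    ∀ δ > 0, ∀ᶠ j in atTop, r - δ ≤ Real.logb 2 (Fintype.card (E j).M) / n j

end

end Wiretap

open Wiretap

namespace Wiretap

noncomputable section

universe u v w

/-! ## Distributions and outputs -/

section Basic

variable {α : Type u} [Fintype α] {X : Type v} {Z : Type w} [Fintype Z]

lemma distr_nonneg (P : Distr α) (a : α) : 0 ≤ P a := P.2.1 a

lemma distr_sum (P : Distr α) : ∑ a, P a = 1 := P.2.2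

lemma distr_le_one (P : Distr α) (a : α) : P a ≤ 1 :=
  (mem_Icc_of_mem_stdSimplex P.2 a).2

lemma uniform_apply [Nonempty α] (a : α) : uniform α a = (Fintype.card α : ℝ)⁻¹ := rfl

lemma output_apply (P : Distr α) (W : Channel α Z) (z : Z) :
    output P W z = ∑ x, P x * W x z := rfl

lemma prodChannel_apply {n : ℕ} (W : Fin n → Channel X Z) (x : Fin n → X) (z : Fin n → Z) :
    prodChannel W x z = ∏ i, W i (x i) (z i) := rfl

lemma output_map [Fintype X] {R : Type*} [Fintype R] (f : R → X) (P : Distr R)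
    (W : Channel X Z) (z : Z) :
    output (stdSimplex.map f P) W z = ∑ r, P r * W (f r) z := by
  rw [output_apply]
  have h : ∀ x, (stdSimplex.map f P) x = ∑ r, if f r = x then P r else 0 := by
    intro x
    rw [stdSimplex.map_coe, FunOnFinite.linearMap_apply_apply, Finset.sum_filter]
  simp_rw [h, Finset.sum_mul, ite_mul, zero_mul]
  rw [Finset.sum_comm]
  simp

end Basic

/-! ## The leftover hash lemma -/

section Hash

variable {V : Type} [Fintype V] (H : InvertibleHash V) {O : Type u} [Fintype O]

/-- The output distribution of `κ` when the message `m` is inverted with seed `s`. -/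
def InvertibleHash.hashOutput (κ : V → O → ℝ) (m : H.M) (s : H.S) (z : O) : ℝ :=
  (Fintype.card H.R : ℝ)⁻¹ * ∑ r, κ (H.inv m s r) z

/-- The average distance, over the seed, between the output for message `m` and the output for
uniform input. -/
def InvertibleHash.hashDistance (κ : V → O → ℝ) (m : H.M) : ℝ :=
  (Fintype.card H.S : ℝ)⁻¹ * ∑ s, ∑ z,
    |H.hashOutput κ m s z - (Fintype.card V : ℝ)⁻¹ * ∑ v, κ v z|

lemma InvertibleHash.card_fiber_pos (m : H.M) (s : H.S) :
    0 < Fintype.card {v : V // H.ext v s = m} := by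
  by_contra h0
  have h1 : Fintype.card {v : V // H.ext v s = m} = 0 := by omega
  obtain ⟨r⟩ := H.nonemptyR
  have h2 := H.inverter m s (H.inv m s r)
  rw [h1] at h2
  have h3 : (0 : ℝ) < (Fintype.card {r' : H.R // H.inv m s r' = H.inv m s r} : ℝ) /
      Fintype.card H.R := by
    have : 0 < Fintype.card {r' : H.R // H.inv m s r' = H.inv m s r} :=
      Fintype.card_pos_iff.2 ⟨⟨r, rfl⟩⟩
    have : 0 < Fintype.card H.R := Fintype.card_pos_iff.2 ⟨r⟩
    positivity
  rw [h2] at h3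
  simp at h3

lemma InvertibleHash.hashOutput_eq {O : Type u} (κ : V → O → ℝ) (m : H.M) (s : H.S) (z : O) :
    H.hashOutput κ m s z = (Fintype.card {v : V // H.ext v s = m} : ℝ)⁻¹ *
      ∑ v, if H.ext v s = m then κ v z else 0 := by
  have h : ∑ r, κ (H.inv m s r) z =
      ∑ v, (Fintype.card {r : H.R // H.inv m s r = v} : ℝ) * κ v z := by
    rw [← Finset.sum_fiberwise_of_maps_to (t := Finset.univ) (g := fun r => H.inv m s r)
      (fun _ _ => Finset.mem_univ _)]
    refine Finset.sum_congr rfl fun v _ => ?_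
    rw [Finset.sum_congr rfl (g := fun _ => κ v z), Finset.sum_const, nsmul_eq_mul,
      Fintype.card_subtype]
    intro r hr
    rw [(Finset.mem_filter.1 hr).2]
  rw [InvertibleHash.hashOutput, h, Finset.mul_sum, Finset.mul_sum]
  refine Finset.sum_congr rfl fun v _ => ?_
  have := H.inverter m s v
  rw [div_eq_inv_mul] at this
  rw [← mul_assoc, this]
  split_ifs <;> simp

lemma sum_sum_ite_eq {M : Type*} [Fintype M] (e : V → M) (g : V → ℝ) :
    ∑ m, ∑ v, (if e v = m then g v else 0) = ∑ v, g v := by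
  rw [Finset.sum_comm]; simp

lemma InvertibleHash.sum_seed_collision (g : V → ℝ) (hg : ∀ v, 0 ≤ g v) :
    ∑ s, ∑ m, (∑ v, if H.ext v s = m then g v else 0) ^ 2 ≤
      Fintype.card H.S * (∑ v, g v ^ 2 + (∑ v, g v) ^ 2 / Fintype.card H.M) := by
  have hS : (0 : ℝ) < Fintype.card H.S := by exact_mod_cast Fintype.card_pos
  have h1 : ∀ s, ∑ m, (∑ v, if H.ext v s = m then g v else 0) ^ 2 =
      ∑ v, ∑ v', if H.ext v s = H.ext v' s then g v * g v' else 0 := by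
    intro s
    simp_rw [sq, Finset.sum_mul_sum]
    rw [Finset.sum_comm]
    refine Finset.sum_congr rfl fun v _ => ?_
    rw [Finset.sum_comm]
    refine Finset.sum_congr rfl fun v' _ => ?_
    rw [Finset.sum_eq_single (H.ext v s)]
    · by_cases h : H.ext v s = H.ext v' s <;> simp [h, eq_comm]
    · intro m _ hm; simp [Ne.symm hm]
    · simp
  simp_rw [h1]
  rw [Finset.sum_comm]
  have h2 : ∀ v v', ∑ s, (if H.ext v s = H.ext v' s then g v * g v' else 0) ≤
      Fintype.card H.S * ((if v = v' then g v ^ 2 else 0) + g v * g v' / Fintype.card H.M) := by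
    intro v v'
    have hn : 0 ≤ g v * g v' / Fintype.card H.M :=
      div_nonneg (mul_nonneg (hg v) (hg v')) (Nat.cast_nonneg _)
    by_cases h : v = v'
    · subst h
      simp only [if_true, Finset.sum_const, Finset.card_univ, nsmul_eq_mul]
      gcongr
      rw [sq]; linarith
    · have := H.two_universal v v' h
      rw [div_le_div_iff₀ hS (by exact_mod_cast Fintype.card_pos), one_mul,
        Fintype.card_subtype] at this
      rw [← Finset.sum_filter, Finset.sum_const, nsmul_eq_mul]
      have hM : (0 : ℝ) < Fintype.card H.M := by exact_mod_cast Fintype.card_pos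
      simp only [h, if_false, zero_add]
      rw [mul_div_assoc', le_div_iff₀ hM]
      calc _ = g v * g v' * (((Finset.univ.filter fun s => H.ext v s = H.ext v' s).card : ℝ) *
            Fintype.card H.M) := by ring
        _ ≤ g v * g v' * Fintype.card H.S :=
            mul_le_mul_of_nonneg_left this (mul_nonneg (hg v) (hg v'))
        _ = _ := by ring
  calc _ = ∑ v, ∑ v', ∑ s, (if H.ext v s = H.ext v' s then g v * g v' else 0) :=
        Finset.sum_congr rfl fun v _ => Finset.sum_comm
    _ ≤ ∑ v, ∑ v', Fintype.card H.S *
        ((if v = v' then g v ^ 2 else 0) + g v * g v' / Fintype.card H.M) :=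
        Finset.sum_le_sum fun v _ => Finset.sum_le_sum fun v' _ => h2 v v'
    _ = _ := by
        simp_rw [← Finset.mul_sum, Finset.sum_add_distrib, ← Finset.sum_div,
          ← Finset.mul_sum, ← Finset.sum_mul]
        simp [sq]

lemma InvertibleHash.sum_sq_deviation (g : V → ℝ) (hg : ∀ v, 0 ≤ g v) :
    ∑ s, ∑ m, ((∑ v, if H.ext v s = m then g v else 0) - (∑ v, g v) / Fintype.card H.M) ^ 2 ≤
      Fintype.card H.S * ∑ v, g v ^ 2 := by
  have hM : (0 : ℝ) < Fintype.card H.M := by exact_mod_cast Fintype.card_pos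
  have h1 : ∀ s, ∑ m, ((∑ v, if H.ext v s = m then g v else 0) -
      (∑ v, g v) / Fintype.card H.M) ^ 2 =
      ∑ m, (∑ v, if H.ext v s = m then g v else 0) ^ 2 - (∑ v, g v) ^ 2 / Fintype.card H.M := by
    intro s
    simp_rw [sub_sq, Finset.sum_add_distrib, Finset.sum_sub_distrib, ← Finset.sum_mul,
      ← Finset.mul_sum, sum_sum_ite_eq]
    simp only [Finset.sum_const, Finset.card_univ, nsmul_eq_mul]
    field_simp
    ring
  simp_rw [h1, Finset.sum_sub_distrib]
  have := H.sum_seed_collision g hg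
  simp only [Finset.sum_const, Finset.card_univ, nsmul_eq_mul]
  linarith

lemma InvertibleHash.sum_abs_deviation_le (κ : V → O → ℝ) (hκ : ∀ v z, 0 ≤ κ v z)
    (hκ1 : ∀ v, ∑ z, κ v z ≤ 1) (U : O → ℝ) (hU : ∀ z, 0 ≤ U z) (hU1 : ∑ z, U z ≤ 1) (β : ℝ)
    (hβ : 0 ≤ β) (h : ∀ v z, κ v z ≤ β * U z) :
    ∑ z, ∑ s, ∑ m, |(∑ v, if H.ext v s = m then κ v z else 0) -
      (∑ v, κ v z) / Fintype.card H.M| ≤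
      Fintype.card H.S * √(Fintype.card H.M * Fintype.card V * β) := by
  have hM : (0 : ℝ) < Fintype.card H.M := by exact_mod_cast Fintype.card_pos
  set r : O × H.S × H.M → ℝ := fun a => (∑ v, if H.ext v a.2.1 = a.2.2 then κ v a.1 else 0) -
      (∑ v, κ v a.1) / Fintype.card H.M with hr
  have e1 : ∑ z, ∑ s, ∑ m, |(∑ v, if H.ext v s = m then κ v z else 0) -
      (∑ v, κ v z) / Fintype.card H.M| = ∑ a, |r a| := by
    simp_rw [Fintype.sum_prod_type, hr]
  have hz : ∀ a, U a.1 = 0 → r a = 0 := by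
    intro a ha
    have : ∀ v, κ v a.1 = 0 := fun v => le_antisymm (by simpa [ha] using h v a.1) (hκ v _)
    simp [hr, this]
  have hcs := Finset.sum_sq_le_sum_mul_sum_of_sq_le_mul Finset.univ (r := fun a => |r a|)
    (f := fun a => U a.1) (g := fun a => r a ^ 2 / U a.1)
    (fun a _ => hU _) (fun a _ => div_nonneg (sq_nonneg _) (hU _)) (by
      intro a _
      by_cases ha : U a.1 = 0
      · simp [hz a ha]
      · rw [sq_abs]; field_simp; rfl)
  have e2 : ∑ a : O × H.S × H.M, U a.1 ≤ Fintype.card H.S * Fintype.card H.M := by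
    simp_rw [Fintype.sum_prod_type]
    simp only [Finset.sum_const, Finset.card_univ, nsmul_eq_mul, ← Finset.mul_sum]
    calc _ = (Fintype.card H.S * Fintype.card H.M : ℝ) * ∑ z, U z := by ring
      _ ≤ (Fintype.card H.S * Fintype.card H.M : ℝ) * 1 := by gcongr
      _ = _ := mul_one _
  have e3 : ∑ a, r a ^ 2 / U a.1 ≤ Fintype.card H.S * (Fintype.card V * β) := by
    simp_rw [Fintype.sum_prod_type]
    calc _ = ∑ z, (∑ s, ∑ m, r (z, s, m) ^ 2) / U z := by simp_rw [Finset.sum_div]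
      _ ≤ ∑ z, Fintype.card H.S * ∑ v, κ v z * β := by
          refine Finset.sum_le_sum fun z _ => ?_
          by_cases hz0 : U z = 0
          · rw [hz0, div_zero]
            exact mul_nonneg (Nat.cast_nonneg _)
              (Finset.sum_nonneg fun v _ => mul_nonneg (hκ _ _) hβ)
          · have hz1 : 0 < U z := lt_of_le_of_ne (hU z) (Ne.symm hz0)
            rw [div_le_iff₀ hz1, mul_assoc, Finset.sum_mul]
            refine (H.sum_sq_deviation (fun v => κ v z) (fun v => hκ v z)).trans ?_
            gcongr with v
            rw [sq, mul_assoc]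
            exact mul_le_mul_of_nonneg_left (h v z) (hκ v z)
      _ = Fintype.card H.S * ∑ v, (∑ z, κ v z) * β := by
          rw [← Finset.mul_sum, Finset.sum_comm]; simp_rw [Finset.sum_mul]
      _ ≤ Fintype.card H.S * ∑ v : V, 1 * β := by
          gcongr with v
          exact hκ1 v
      _ = _ := by simp
  rw [e1]
  have e4 : (∑ a, |r a|) ^ 2 ≤
      (Fintype.card H.S : ℝ) ^ 2 * (Fintype.card H.M * Fintype.card V * β) := by
    refine hcs.trans ?_
    calc _ ≤ (Fintype.card H.S * Fintype.card H.M : ℝ) *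
          (Fintype.card H.S * (Fintype.card V * β)) :=
          mul_le_mul e2 e3 (Finset.sum_nonneg fun a _ => div_nonneg (sq_nonneg _) (hU _))
            (by positivity)
      _ = _ := by ring
  have := Real.le_sqrt_of_sq_le e4
  rwa [Real.sqrt_mul (by positivity), Real.sqrt_sq (by positivity)] at this

/-- Leftover hash lemma: for a uniform message the output is close, on average, to the output for
uniform input. -/
theorem InvertibleHash.hashDistance_le [Nonempty V] (κ : V → O → ℝ) (hκ : ∀ v z, 0 ≤ κ v z)
    (hκ1 : ∀ v, ∑ z, κ v z = 1) (U : O → ℝ) (hU : ∀ z, 0 ≤ U z) (hU1 : ∑ z, U z ≤ 1) (β : ℝ)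
    (hβ : 0 ≤ β) (τ : ℝ) (hτ : ∀ v, ∑ z, (if κ v z ≤ β * U z then 0 else κ v z) ≤ τ) :
    (Fintype.card H.M : ℝ)⁻¹ * ∑ m, H.hashDistance κ m ≤
      2 * √(Fintype.card H.M * β / Fintype.card V) + 4 * τ := by
  have hM : (0 : ℝ) < Fintype.card H.M := by exact_mod_cast Fintype.card_pos
  have hS : (0 : ℝ) < Fintype.card H.S := by exact_mod_cast Fintype.card_pos
  have hV : (0 : ℝ) < Fintype.card V := by exact_mod_cast Fintype.card_pos
  set κ' : V → O → ℝ := fun v z => if κ v z ≤ β * U z then κ v z else 0 with hκ'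
  set κ'' : V → O → ℝ := fun v z => if κ v z ≤ β * U z then 0 else κ v z with hκ''
  have hadd : ∀ v z, κ v z = κ' v z + κ'' v z := by
    intro v z; simp only [hκ', hκ'']; split_ifs <;> simp
  have n1 : ∀ v z, 0 ≤ κ' v z := by
    intro v z; simp only [hκ']; split_ifs; exacts [hκ v z, le_rfl]
  have n2 : ∀ v z, 0 ≤ κ'' v z := by
    intro v z; simp only [hκ'']; split_ifs; exacts [le_rfl, hκ v z]
  let A : (V → O → ℝ) → H.M → H.S → O → ℝ :=
    fun κ m s z => ∑ v, if H.ext v s = m then κ v z else 0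
  have hA : ∀ m s z, A κ m s z = A κ' m s z + A κ'' m s z := by
    intro m s z
    simp only [A, ← Finset.sum_add_distrib]
    refine Finset.sum_congr rfl fun v _ => ?_
    split_ifs; exacts [hadd v z, (add_zero _).symm]
  let Δ : (V → O → ℝ) → H.M → H.S → O → ℝ :=
    fun κ m s z => |A κ m s z - (∑ v, κ v z) / Fintype.card H.M|
  -- replace the normalisation by the fibre size by a uniform one
  have p1 : ∀ m s, (Fintype.card H.M : ℝ)⁻¹ * ∑ z,
      |H.hashOutput κ m s z - (Fintype.card V : ℝ)⁻¹ * ∑ v, κ v z| ≤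
      2 * ((Fintype.card V : ℝ)⁻¹ * ∑ z, Δ κ m s z) := by
    intro m s
    set N : ℝ := (Fintype.card {v : V // H.ext v s = m} : ℝ) with hN
    have hN0 : 0 < N := by rw [hN]; exact_mod_cast H.card_fiber_pos m s
    have hAn : ∀ z, 0 ≤ A κ m s z := fun z => Finset.sum_nonneg fun v _ => by
      split_ifs; exacts [hκ v z, le_rfl]
    have hAs : ∑ z, A κ m s z = N := by
      simp only [A]
      rw [Finset.sum_comm, hN, Fintype.card_subtype, ← Finset.sum_boole]
      refine Finset.sum_congr rfl fun v _ => ?_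
      split_ifs <;> simp [hκ1]
    have hQs : ∑ z, ∑ v, κ v z = Fintype.card V := by
      rw [Finset.sum_comm]; simp [hκ1]
    have q1 : |N / Fintype.card V - (Fintype.card H.M : ℝ)⁻¹| ≤
        (Fintype.card V : ℝ)⁻¹ * ∑ z, Δ κ m s z := by
      have : N / Fintype.card V - (Fintype.card H.M : ℝ)⁻¹ = (Fintype.card V : ℝ)⁻¹ *
          ∑ z, (A κ m s z - (∑ v, κ v z) / Fintype.card H.M) := by
        rw [Finset.sum_sub_distrib, hAs, ← Finset.sum_div, hQs]
        field_simp
      rw [this, abs_mul, abs_of_pos (inv_pos.2 hV)]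
      gcongr
      exact Finset.abs_sum_le_sum_abs _ _
    have q2 : ∀ z, (Fintype.card H.M : ℝ)⁻¹ *
        |H.hashOutput κ m s z - (Fintype.card V : ℝ)⁻¹ * ∑ v, κ v z| ≤
        |N / Fintype.card V - (Fintype.card H.M : ℝ)⁻¹| * (N⁻¹ * A κ m s z) +
          (Fintype.card V : ℝ)⁻¹ * Δ κ m s z := by
      intro z
      rw [H.hashOutput_eq, ← hN, ← abs_of_pos (inv_pos.2 hM), ← abs_mul,
        abs_of_pos (inv_pos.2 hM)]
      have : (Fintype.card H.M : ℝ)⁻¹ * (N⁻¹ * A κ m s z - (Fintype.card V : ℝ)⁻¹ * ∑ v, κ v z) =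
          -((N / Fintype.card V - (Fintype.card H.M : ℝ)⁻¹) * (N⁻¹ * A κ m s z)) +
          (Fintype.card V : ℝ)⁻¹ * (A κ m s z - (∑ v, κ v z) / Fintype.card H.M) := by
        field_simp; ring
      refine (congrArg abs this).le.trans ((abs_add_le _ _).trans ?_)
      rw [abs_neg, abs_mul, abs_of_nonneg (mul_nonneg (inv_pos.2 hN0).le (hAn z)),
        abs_mul (Fintype.card V : ℝ)⁻¹, abs_of_pos (inv_pos.2 hV)]
    rw [Finset.mul_sum]
    refine (Finset.sum_le_sum fun z _ => q2 z).trans ?_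
    rw [Finset.sum_add_distrib, ← Finset.mul_sum, ← Finset.mul_sum, ← Finset.mul_sum, hAs,
      inv_mul_cancel₀ hN0.ne', mul_one]
    linarith
  have p2 : ∀ m s z, Δ κ m s z ≤ Δ κ' m s z +
      (A κ'' m s z + (∑ v, κ'' v z) / Fintype.card H.M) := by
    intro m s z
    have : A κ m s z - (∑ v, κ v z) / Fintype.card H.M =
        (A κ' m s z - (∑ v, κ' v z) / Fintype.card H.M) +
        (A κ'' m s z - (∑ v, κ'' v z) / Fintype.card H.M) := by
      rw [hA, Finset.sum_congr rfl fun v _ => hadd v z, Finset.sum_add_distrib]; ring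
    simp only [Δ, this]
    refine (abs_add_le _ _).trans (add_le_add le_rfl ((abs_sub _ _).trans ?_))
    rw [abs_of_nonneg, abs_of_nonneg]
    · exact div_nonneg (Finset.sum_nonneg fun v _ => n2 v z) hM.le
    · exact Finset.sum_nonneg fun v _ => by split_ifs; exacts [n2 v z, le_rfl]
  have p3 : ∑ z, ∑ s, ∑ m, (A κ'' m s z + (∑ v, κ'' v z) / Fintype.card H.M) ≤
      Fintype.card H.S * (2 * (Fintype.card V * τ)) := by
    have : ∀ z s, ∑ m, (A κ'' m s z + (∑ v, κ'' v z) / Fintype.card H.M) =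
        2 * ∑ v, κ'' v z := by
      intro z s
      rw [Finset.sum_add_distrib]
      simp only [A]
      rw [sum_sum_ite_eq]
      simp only [Finset.sum_const, Finset.card_univ, nsmul_eq_mul]
      field_simp; ring
    simp_rw [this]
    simp only [Finset.sum_const, Finset.card_univ, nsmul_eq_mul]
    rw [← Finset.mul_sum, ← Finset.mul_sum, Finset.sum_comm]
    gcongr
    refine (Finset.sum_le_sum fun v _ => hτ v).trans ?_
    simp
  have p4 : ∑ z, ∑ s, ∑ m, Δ κ' m s z ≤
      Fintype.card H.S * √(Fintype.card H.M * Fintype.card V * β) := by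
    refine H.sum_abs_deviation_le κ' n1 (fun v => ?_) U hU hU1 β hβ ?_
    · rw [← hκ1 v]
      refine Finset.sum_le_sum fun z _ => ?_
      rw [hadd v z]; linarith [n2 v z]
    · intro v z
      simp only [hκ']; split_ifs with h
      exacts [h, mul_nonneg hβ (hU z)]
  have p5 : ∑ z, ∑ s, ∑ m, Δ κ m s z ≤
      Fintype.card H.S * √(Fintype.card H.M * Fintype.card V * β) +
      Fintype.card H.S * (2 * (Fintype.card V * τ)) := by
    refine le_trans ?_ (add_le_add p4 p3)
    simp_rw [← Finset.sum_add_distrib]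
    exact Finset.sum_le_sum fun z _ => Finset.sum_le_sum fun s _ =>
      Finset.sum_le_sum fun m _ => p2 m s z
  have p6 : (Fintype.card H.M : ℝ)⁻¹ * ∑ m, H.hashDistance κ m ≤
      (Fintype.card H.S : ℝ)⁻¹ * (2 * ((Fintype.card V : ℝ)⁻¹ *
        ∑ z, ∑ s, ∑ m, Δ κ m s z)) := by
    calc _ = (Fintype.card H.S : ℝ)⁻¹ * ∑ m, ∑ s, (Fintype.card H.M : ℝ)⁻¹ * ∑ z,
          |H.hashOutput κ m s z - (Fintype.card V : ℝ)⁻¹ * ∑ v, κ v z| := by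
          simp_rw [InvertibleHash.hashDistance, ← Finset.mul_sum]; ring
      _ ≤ (Fintype.card H.S : ℝ)⁻¹ * ∑ m, ∑ s,
          2 * ((Fintype.card V : ℝ)⁻¹ * ∑ z, Δ κ m s z) := by
          refine mul_le_mul_of_nonneg_left ?_ (inv_nonneg.2 hS.le)
          exact Finset.sum_le_sum fun m _ => Finset.sum_le_sum fun s _ => p1 m s
      _ = _ := by
          simp_rw [← Finset.mul_sum]
          congr 3
          rw [Finset.sum_comm]
          rw [Finset.sum_congr rfl fun s _ => Finset.sum_comm]
          rw [Finset.sum_comm]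
  refine p6.trans ?_
  have hsq : √(Fintype.card H.M * Fintype.card V * β : ℝ) =
      Fintype.card V * √(Fintype.card H.M * β / Fintype.card V) := by
    rw [show (Fintype.card H.M * Fintype.card V * β : ℝ) =
      (Fintype.card V : ℝ) ^ 2 * (Fintype.card H.M * β / Fintype.card V) by field_simp,
      Real.sqrt_mul (by positivity), Real.sqrt_sq hV.le]
  rw [hsq] at p5
  calc _ ≤ (Fintype.card H.S : ℝ)⁻¹ * (2 * ((Fintype.card V : ℝ)⁻¹ * (Fintype.card H.S *
        (Fintype.card V * √(Fintype.card H.M * β / Fintype.card V)) +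
        Fintype.card H.S * (2 * (Fintype.card V * τ))))) := by gcongr
    _ = _ := by field_simp; ring

end Hash

/-! ## Sums of independent random variables -/

section Independent

variable {α : Type u} [Fintype α]

lemma sum_fin_succ_pi {n : ℕ} (F : (Fin (n + 1) → α) → ℝ) :
    ∑ z, F z = ∑ a, ∑ z : Fin n → α, F (Fin.cons a z) := by
  rw [← Fintype.sum_prod_type', ← (Fin.consEquiv fun _ => α).sum_comp]
  rfl

lemma sum_prod_eq_one {n : ℕ} (P : Fin n → α → ℝ) (hP : ∀ i, ∑ a, P i a = 1) :
    ∑ z : Fin n → α, ∏ i, P i (z i) = 1 := by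
  rw [← Fintype.piFinset_univ, ← Finset.prod_univ_sum]
  simp [hP]

lemma sum_prod_mul_sum {n : ℕ} (P Y : Fin n → α → ℝ) (hP : ∀ i, ∑ a, P i a = 1)
    (hY : ∀ i, ∑ a, P i a * Y i a = 0) :
    ∑ z : Fin n → α, (∏ i, P i (z i)) * ∑ i, Y i (z i) = 0 := by
  induction n with
  | zero => simp
  | succ n ih =>
    rw [sum_fin_succ_pi]
    simp only [Fin.prod_univ_succ, Fin.sum_univ_succ, Fin.cons_zero, Fin.cons_succ]
    have h1 := sum_prod_eq_one (fun i => P i.succ) fun i => hP i.succ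
    have h2 := ih (fun i => P i.succ) (fun i => Y i.succ) (fun i => hP _) fun i => hY _
    calc _ = ∑ a, (P 0 a * Y 0 a * ∑ z : Fin n → α, ∏ i, P i.succ (z i) +
          P 0 a * ∑ z : Fin n → α, (∏ i, P i.succ (z i)) * ∑ i, Y i.succ (z i)) := by
          refine Finset.sum_congr rfl fun a _ => ?_
          rw [Finset.mul_sum, Finset.mul_sum, ← Finset.sum_add_distrib]
          exact Finset.sum_congr rfl fun z _ => by ring
      _ = 0 := by simp [h1, h2, hY]

/-- The variance of a sum of independent centred random variables. -/
lemma sum_prod_mul_sq_sum {n : ℕ} (P Y : Fin n → α → ℝ) (hP : ∀ i, ∑ a, P i a = 1)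
    (hY : ∀ i, ∑ a, P i a * Y i a = 0) :
    ∑ z : Fin n → α, (∏ i, P i (z i)) * (∑ i, Y i (z i)) ^ 2 =
      ∑ i, ∑ a, P i a * Y i a ^ 2 := by
  induction n with
  | zero => simp
  | succ n ih =>
    rw [sum_fin_succ_pi]
    simp only [Fin.prod_univ_succ, Fin.sum_univ_succ, Fin.cons_zero, Fin.cons_succ]
    have h1 := sum_prod_eq_one (fun i => P i.succ) fun i => hP i.succ
    have h2 := sum_prod_mul_sum (fun i => P i.succ) (fun i => Y i.succ) (fun i => hP _)
      fun i => hY _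
    have h3 := ih (fun i => P i.succ) (fun i => Y i.succ) (fun i => hP _) fun i => hY _
    calc _ = ∑ a, (P 0 a * Y 0 a ^ 2 * ∑ z : Fin n → α, ∏ i, P i.succ (z i) +
          2 * (P 0 a * Y 0 a) *
            (∑ z : Fin n → α, (∏ i, P i.succ (z i)) * ∑ i, Y i.succ (z i)) +
          P 0 a * ∑ z : Fin n → α, (∏ i, P i.succ (z i)) * (∑ i, Y i.succ (z i)) ^ 2) := by
          refine Finset.sum_congr rfl fun a _ => ?_
          rw [Finset.mul_sum, Finset.mul_sum, Finset.mul_sum, ← Finset.sum_add_distrib,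
            ← Finset.sum_add_distrib]
          exact Finset.sum_congr rfl fun z _ => by ring
      _ = _ := by
          rw [h1, h2, h3, Finset.sum_add_distrib, ← Finset.sum_mul _ _ (∑ i, _), hP]
          simp

end Independent

/-! ## Symmetric channels -/

section Symmetric

variable {X : Type u} {Z : Type v} [Fintype X] [Fintype Z] {W : Channel X Z}

lemma IsSymmetric.sum_eq (hW : IsSymmetric W) (φ : ℝ → ℝ → ℝ) (x x' : X) :
    ∑ z, φ (W x z) (∑ y, W y z) = ∑ z, φ (W x' z) (∑ y, W y z) := by
  obtain ⟨r, hr⟩ := hW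
  rw [← Finset.sum_fiberwise Finset.univ (fun z => Quotient.mk r z),
    ← Finset.sum_fiberwise Finset.univ (fun z => Quotient.mk r z) fun z => φ (W x' z) _]
  refine Finset.sum_congr rfl fun q _ => ?_
  induction q using Quotient.inductionOn with
  | h z₀ =>
    have e : ∀ F : Z → ℝ, ∑ z with Quotient.mk r z = Quotient.mk r z₀, F z =
        ∑ z : ({z | r z z₀} : Set Z), F z := by
      intro F
      rw [← Finset.sum_subtype (p := fun z => z ∈ ({z | r z z₀} : Set Z))]
      intro z
      simp [Quotient.eq]
    rw [e, e]
    obtain ⟨π, hπ⟩ := (hr z₀).1 x x'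
    rw [← Equiv.sum_comp π fun z => φ (W x' z) (∑ y, W y z)]
    refine Finset.sum_congr rfl fun z _ => ?_
    obtain ⟨σ, hσ⟩ := (hr z₀).2 z (π z)
    rw [hπ z]
    congr 1
    rw [Finset.sum_congr rfl fun y _ => hσ y]
    exact Equiv.sum_comp σ fun y => W y (π z)

variable [Nonempty X]

lemma output_uniform_apply (W : Channel X Z) (z : Z) :
    output (uniform X) W z = (Fintype.card X : ℝ)⁻¹ * ∑ x, W x z := by
  rw [output_apply, Finset.mul_sum]; rfl

lemma uniformInfo_eq (W : Channel X Z) :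
    uniformInfo W = (Fintype.card X : ℝ)⁻¹ * ∑ x, ∑ z, W x z *
      (Real.logb 2 (W x z) - Real.logb 2 (output (uniform X) W z)) := by
  simp only [uniformInfo, mutualInfo, entropy, mul_sub, Finset.sum_sub_distrib, uniform_apply]
  rw [Finset.sum_comm (γ := X) (f := fun x z => (W x z) * Real.logb 2 (output (uniform X) W z))]
  simp_rw [← Finset.sum_mul, mul_neg, Finset.sum_neg_distrib, ← Finset.mul_sum]
  have : ∑ a, output (uniform X) W a * Real.logb 2 (output (uniform X) W a) =
      (Fintype.card X : ℝ)⁻¹ * ∑ a, (∑ x, W x a) * Real.logb 2 (output (uniform X) W a) := by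
    rw [Finset.mul_sum]
    refine Finset.sum_congr rfl fun a _ => ?_
    rw [← mul_assoc, ← output_uniform_apply]
  rw [this]; ring

/-- The information density of the uniform input, centred. -/
def infoDensity (W : Channel X Z) (x : X) (z : Z) : ℝ :=
  Real.logb 2 (W x z) - Real.logb 2 (output (uniform X) W z) - uniformInfo W

/-- For symmetric channels the expectation of the information density does not depend on the
input. -/
lemma IsSymmetric.sum_mul_infoDensity (hW : IsSymmetric W) (x : X) :
    ∑ z, W x z * infoDensity W x z = 0 := by
  have h := fun x' => hW.sum_eq (fun a b => a * (Real.logb 2 a -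
    Real.logb 2 ((Fintype.card X : ℝ)⁻¹ * b))) x' x
  simp_rw [← output_uniform_apply] at h
  have hI := uniformInfo_eq W
  rw [Finset.sum_congr rfl fun x' _ => h x', Finset.sum_const, Finset.card_univ, nsmul_eq_mul,
    inv_mul_cancel_left₀ (by exact_mod_cast Fintype.card_ne_zero)] at hI
  simp only [infoDensity, mul_sub (W x _) (_ - _) (uniformInfo W), Finset.sum_sub_distrib]
  rw [← hI, ← Finset.sum_mul, distr_sum]; ring

lemma le_output_uniform_mul (W : Channel X Z) (x : X) (z : Z) (h : 0 < W x z) :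
    0 < output (uniform X) W z := by
  rw [output_uniform_apply]
  have h1 : W x z ≤ ∑ x, W x z :=
    Finset.single_le_sum (f := fun x => W x z) (fun y _ => distr_nonneg (W y) z)
      (Finset.mem_univ x)
  have : (0 : ℝ) < Fintype.card X := by exact_mod_cast Fintype.card_pos
  have : 0 < ∑ x, W x z := h.trans_le h1
  positivity

/-- Chebyshev's inequality for the information density of a product of symmetric channels. -/
lemma sum_atypical_le {n : ℕ} (K : Fin n → Channel X Z) (hK : ∀ i, IsSymmetric (K i))
    (x : Fin n → X) (a : ℝ) (ha : 0 < a) :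
    ∑ z, (if prodChannel K x z ≤ (2 : ℝ) ^ (∑ i, uniformInfo (K i) + a) *
        ∏ i, output (uniform X) (K i) (z i) then 0 else prodChannel K x z) ≤
      (∑ i, ∑ z, K i (x i) z * infoDensity (K i) (x i) z ^ 2) / a ^ 2 := by
  have h := sum_prod_mul_sq_sum (fun i z => K i (x i) z) (fun i z => infoDensity (K i) (x i) z)
    (fun i => distr_sum _) fun i => (hK i).sum_mul_infoDensity (x i)
  rw [← h, Finset.sum_div]
  refine Finset.sum_le_sum fun z _ => ?_
  have hp : 0 ≤ ∏ i, K i (x i) (z i) := Finset.prod_nonneg fun i _ => distr_nonneg _ _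
  split_ifs with hc
  · positivity
  · rw [not_le, prodChannel_apply] at hc
    have hU : 0 ≤ ∏ i, output (uniform X) (K i) (z i) :=
      Finset.prod_nonneg fun i _ => distr_nonneg _ _
    have hp0 : 0 < ∏ i, K i (x i) (z i) := lt_of_le_of_lt (by positivity) hc
    have hKi : ∀ i, 0 < K i (x i) (z i) := fun i => lt_of_le_of_ne (distr_nonneg _ _)
      fun h0 => hp0.ne' (Finset.prod_eq_zero (Finset.mem_univ i) h0.symm)
    have hUi : ∀ i, 0 < output (uniform X) (K i) (z i) := fun i =>
      le_output_uniform_mul _ _ _ (hKi i)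
    have hlog : a < ∑ i, infoDensity (K i) (x i) (z i) := by
      have := Real.logb_lt_logb (by norm_num : (1 : ℝ) < 2)
        (mul_pos (by positivity) (Finset.prod_pos fun i _ => hUi i)) hc
      rw [Real.logb_mul (by positivity) (Finset.prod_pos fun i _ => hUi i).ne',
        Real.logb_rpow (by norm_num) (by norm_num),
        Real.logb_prod _ _ (fun i _ => (hUi i).ne'),
        Real.logb_prod _ _ (fun i _ => (hKi i).ne')] at this
      simp only [infoDensity, Finset.sum_sub_distrib]
      linarith
    rw [prodChannel_apply, le_div_iff₀ (by positivity)]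
    refine mul_le_mul_of_nonneg_left ?_ hp
    exact pow_le_pow_left₀ ha.le hlog.le 2

end Symmetric

/-! ## Secrecy of hashing -/

section Secrecy

variable {X : Type} [Fintype X] {Q : Type u} {Z : Type v} [Fintype Z]

lemma sum_stateSequences [Fintype Q] {n : ℕ} {t : Q → ℕ} {w : Fin n → Q}
    (hw : w ∈ stateSequences n t)
    (g : Q → ℝ) : ∑ i, g (w i) = ∑ q, t q * g q := by
  rw [← Finset.sum_fiberwise Finset.univ w]
  refine Finset.sum_congr rfl fun q _ => ?_
  rw [Finset.sum_congr rfl (g := fun _ => g q), Finset.sum_const, nsmul_eq_mul, ← hw q,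
    Fintype.card_subtype]
  intro i hi
  rw [(Finset.mem_filter.1 hi).2]

lemma eavesdropper_protocolEncoder {n : ℕ} {V : Type} [Fintype V] (H : InvertibleHash V)
    (ecc : V → Fin n → X) (W : Q → Channel X Z) (w : Fin n → Q) (m : H.M) (s : H.S)
    (z : Fin n → Z) :
    (protocolEncoder H ecc).eavesdropper W w m s z =
      H.hashOutput (fun v z => prodChannel (fun i => W (w i)) (ecc v) z) m s z := by
  refine (output_map (fun r => ecc (H.inv m s r)) (uniform H.R) _ z).trans ?_
  simp_rw [uniform_apply]
  rw [← Finset.mul_sum]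
  rfl

lemma exists_average_hashDistance_le [Fintype Q] [Nonempty X] (W : Q → Channel X Z)
    (hW : ∀ q, IsSymmetric (W q)) (δ : ℝ) (hδ : 0 < δ) (ε : ℝ) (hε : 0 < ε) :
    ∃ n₀ : ℕ, ∀ n ≥ n₀, ∀ t : Q → ℕ, ∀ w ∈ stateSequences n t,
      ∀ (V : Type) [Fintype V] [Nonempty V] (ecc : V → Fin n → X) (H : InvertibleHash V),
        Real.logb 2 (Fintype.card H.M) ≤ Real.logb 2 (Fintype.card V)
          - n * ∑ q, (t q : ℝ) / n * uniformInfo (W q) - n * δ →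
        (Fintype.card H.M : ℝ)⁻¹ * ∑ m, H.hashDistance
          (fun v z => prodChannel (fun i => W (w i)) (ecc v) z) m ≤ ε := by
  set c : ℝ := ∑ q, ∑ x, ∑ z, W q x z * infoDensity (W q) x z ^ 2 with hc
  have hpos : ∀ q x, 0 ≤ ∑ z, W q x z * infoDensity (W q) x z ^ 2 := fun q x =>
    Finset.sum_nonneg fun z _ => mul_nonneg (distr_nonneg _ _) (sq_nonneg _)
  have hcle : ∀ q x, ∑ z, W q x z * infoDensity (W q) x z ^ 2 ≤ c := fun q x =>
    (Finset.single_le_sum (f := fun x => ∑ z, W q x z * infoDensity (W q) x z ^ 2)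
      (fun x _ => hpos q x) (Finset.mem_univ x)).trans
    (Finset.single_le_sum (f := fun q => ∑ x, ∑ z, W q x z * infoDensity (W q) x z ^ 2)
      (fun q _ => Finset.sum_nonneg fun x _ => hpos q x) (Finset.mem_univ q))
  have hlim : Tendsto (fun n : ℕ => 2 * √((2 : ℝ) ^ (-(δ / 2) * n)) +
      4 * (c / (δ / 2) ^ 2 * (n : ℝ)⁻¹)) atTop (𝓝 (2 * √0 + 4 * (c / (δ / 2) ^ 2 * 0))) := by
    refine ((Tendsto.sqrt ?_).const_mul 2).add
      ((tendsto_inv_atTop_nhds_zero_nat.const_mul _).const_mul 4)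
    have h1 : ∀ n : ℕ, (2 : ℝ) ^ (-(δ / 2) * n) = ((2 : ℝ) ^ (-(δ / 2))) ^ n := fun n => by
      rw [Real.rpow_mul (by norm_num), Real.rpow_natCast]
    simp_rw [h1]
    exact tendsto_pow_atTop_nhds_zero_of_lt_one (by positivity)
      (Real.rpow_lt_one_of_one_lt_of_neg (by norm_num) (by linarith))
  simp only [Real.sqrt_zero, mul_zero, add_zero] at hlim
  obtain ⟨n₀, hn₀⟩ := eventually_atTop.1 ((hlim.eventually_le_const hε).and
    (eventually_gt_atTop 0))
  refine ⟨n₀, fun n hn t w hw V _ _ ecc H hM => ?_⟩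
  obtain ⟨hb, hnpos⟩ := hn₀ n hn
  have hn0 : (0 : ℝ) < n := by exact_mod_cast hnpos
  refine le_trans ?_ hb
  set K : Fin n → Channel X Z := fun i => W (w i) with hK
  have hI : ∑ i, uniformInfo (K i) = n * ∑ q, (t q : ℝ) / n * uniformInfo (W q) := by
    rw [sum_stateSequences hw fun q => uniformInfo (W q), Finset.mul_sum]
    exact Finset.sum_congr rfl fun q _ => by field_simp
  have ha : 0 < n * (δ / 2) := by positivity
  have hVpos : (0 : ℝ) < Fintype.card V := by exact_mod_cast Fintype.card_pos
  have hMpos : (0 : ℝ) < Fintype.card H.M := by exact_mod_cast Fintype.card_pos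
  refine (H.hashDistance_le (fun v z => prodChannel K (ecc v) z) (fun v z => distr_nonneg _ _)
    (fun v => distr_sum _) (fun z => ∏ i, output (uniform X) (K i) (z i))
    (fun z => Finset.prod_nonneg fun i _ => distr_nonneg _ _)
    (sum_prod_eq_one (fun i z => output (uniform X) (K i) z) fun i => distr_sum _).le
    ((2 : ℝ) ^ (∑ i, uniformInfo (K i) + n * (δ / 2))) (by positivity)
    (c / (δ / 2) ^ 2 * (n : ℝ)⁻¹) fun v => ?_).trans ?_
  · refine (sum_atypical_le K (fun i => hW _) (ecc v) _ ha).trans ?_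
    calc _ ≤ (∑ _i : Fin n, c) / (n * (δ / 2)) ^ 2 := by
          gcongr with i
          exact hcle _ _
      _ = _ := by
          simp only [Finset.sum_const, Finset.card_univ, nsmul_eq_mul, Fintype.card_fin]
          field_simp
  · gcongr
    rw [← Real.logb_le_logb (by norm_num : (1 : ℝ) < 2) (by positivity) (by positivity),
      Real.logb_div (by positivity) (by positivity), Real.logb_mul (by positivity) (by positivity),
      Real.logb_rpow (by norm_num) (by norm_num), Real.logb_rpow (by norm_num) (by norm_num), hI]
    linarith

lemma isSecretForRandomMessages_protocolEncoder {n : ℕ} {V : Type} [Fintype V]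
    (H : InvertibleHash V) (ecc : V → Fin n → X) (W : Q → Channel X Z) (t : Q → ℕ) (ε : ℝ)
    (h : ∀ w ∈ stateSequences n t, (Fintype.card H.M : ℝ)⁻¹ * ∑ m, H.hashDistance
      (fun v z => prodChannel (fun i => W (w i)) (ecc v) z) m ≤ ε) :
    (protocolEncoder H ecc).IsSecretForRandomMessages W t ε := by
  intro w hw
  refine le_trans ?_ (h w hw)
  set κ : V → (Fin n → Z) → ℝ := fun v z => prodChannel (fun i => W (w i)) (ecc v) z
  suffices hs : variationalDistance (fun a : H.M × H.S × (Fin n → Z) => 1 / (Fintype.card H.M : ℝ) *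
    (1 / (Fintype.card H.S : ℝ) * H.hashOutput κ a.1 a.2.1 a.2.2))
    (fun a : H.M × H.S × (Fin n → Z) => 1 / (Fintype.card H.M : ℝ) *
    ∑ m' : H.M, 1 / (Fintype.card H.M : ℝ) *
    (1 / (Fintype.card H.S : ℝ) * H.hashOutput κ m' a.2.1 a.2.2)) ≤
      (Fintype.card H.M : ℝ)⁻¹ * ∑ m, H.hashDistance κ m by
    have he := eavesdropper_protocolEncoder H ecc W w
    refine (congrArg₂ variationalDistance (funext fun a => ?_) (funext fun a => ?_)).trans_le hs
    · exact congrArg (fun x : ℝ => 1 / (Fintype.card H.M : ℝ) * (1 / (Fintype.card H.S : ℝ) * x))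
        (he a.1 a.2.1 a.2.2)
    · exact congrArg (fun x : ℝ => 1 / (Fintype.card H.M : ℝ) * x) (Finset.sum_congr rfl
        fun m' _ => congrArg (fun x : ℝ => 1 / (Fintype.card H.M : ℝ) *
          (1 / (Fintype.card H.S : ℝ) * x)) (he m' a.2.1 a.2.2))
  have hM : (0 : ℝ) < Fintype.card H.M := by exact_mod_cast Fintype.card_pos
  have hS : (0 : ℝ) < Fintype.card H.S := by exact_mod_cast Fintype.card_pos
  let d : H.M → H.S → (Fin n → Z) → ℝ := fun m s z =>
    |H.hashOutput κ m s z - (Fintype.card V : ℝ)⁻¹ * ∑ v, κ v z|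
  have hd : ∀ m s z, |1 / (Fintype.card H.M : ℝ) *
      (1 / (Fintype.card H.S : ℝ) * H.hashOutput κ m s z) - 1 / (Fintype.card H.M : ℝ) *
      ∑ m' : H.M, 1 / (Fintype.card H.M : ℝ) *
      (1 / (Fintype.card H.S : ℝ) * H.hashOutput κ m' s z)| ≤
      (Fintype.card H.M : ℝ)⁻¹ * (Fintype.card H.S : ℝ)⁻¹ *
        (d m s z + (Fintype.card H.M : ℝ)⁻¹ * ∑ m', d m' s z) := by
    intro m s z
    have e : 1 / (Fintype.card H.M : ℝ) *
      (1 / (Fintype.card H.S : ℝ) * H.hashOutput κ m s z) - 1 / (Fintype.card H.M : ℝ) *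
      ∑ m' : H.M, 1 / (Fintype.card H.M : ℝ) *
      (1 / (Fintype.card H.S : ℝ) * H.hashOutput κ m' s z) =
      (Fintype.card H.M : ℝ)⁻¹ * (Fintype.card H.S : ℝ)⁻¹ *
      ((H.hashOutput κ m s z - (Fintype.card V : ℝ)⁻¹ * ∑ v, κ v z) -
        (Fintype.card H.M : ℝ)⁻¹ * ∑ m',
          (H.hashOutput κ m' s z - (Fintype.card V : ℝ)⁻¹ * ∑ v, κ v z)) := by
      rw [Finset.sum_sub_distrib]
      simp_rw [← Finset.mul_sum]
      simp only [Finset.sum_const, Finset.card_univ, nsmul_eq_mul]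
      field_simp
      ring
    rw [e, abs_mul, abs_of_pos (by positivity)]
    refine mul_le_mul_of_nonneg_left ((abs_sub _ _).trans (add_le_add le_rfl ?_)) (by positivity)
    rw [abs_mul, abs_of_pos (inv_pos.2 hM)]
    exact mul_le_mul_of_nonneg_left (Finset.abs_sum_le_sum_abs _ _) (by positivity)
  rw [variationalDistance]
  simp_rw [Fintype.sum_prod_type]
  calc _ ≤ 2⁻¹ * ∑ m, ∑ s, ∑ z, (Fintype.card H.M : ℝ)⁻¹ * (Fintype.card H.S : ℝ)⁻¹ *
        (d m s z + (Fintype.card H.M : ℝ)⁻¹ * ∑ m', d m' s z) := by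
        gcongr with m _ s _ z _
        exact hd m s z
    _ = 2⁻¹ * ((Fintype.card H.M : ℝ)⁻¹ * (Fintype.card H.S : ℝ)⁻¹ *
        (∑ m, ∑ s, ∑ z, d m s z + ∑ s, ∑ z, ∑ m', d m' s z)) := by
        simp_rw [← Finset.mul_sum, Finset.sum_add_distrib, ← Finset.mul_sum]
        simp only [Finset.sum_const, Finset.card_univ, nsmul_eq_mul]
        rw [inv_mul_cancel_left₀ hM.ne']
    _ = 2⁻¹ * ((Fintype.card H.M : ℝ)⁻¹ * (Fintype.card H.S : ℝ)⁻¹ *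
        (∑ m, ∑ s, ∑ z, d m s z + ∑ m, ∑ s, ∑ z, d m s z)) := by
        congr 3
        exact (Finset.sum_congr rfl fun s _ => Finset.sum_comm).trans Finset.sum_comm
    _ = _ := by
        simp_rw [InvertibleHash.hashDistance, ← Finset.mul_sum]
        ring

lemma isSecret_protocolEncoder {n : ℕ} {V : Type} [Fintype V]
    (H : InvertibleHash V) (ecc : V → Fin n → X) (W : Q → Channel X Z) (t : Q → ℕ) (ε : ℝ)
    (h : ∀ w ∈ stateSequences n t, ∀ m, H.hashDistance
      (fun v z => prodChannel (fun i => W (w i)) (ecc v) z) m ≤ ε) :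
    (protocolEncoder H ecc).IsSecret W t ε := by
  intro w hw m m'
  have h1 := h w hw m
  have h2 := h w hw m'
  set κ : V → (Fin n → Z) → ℝ := fun v z => prodChannel (fun i => W (w i)) (ecc v) z
  suffices hs : variationalDistance (fun a : H.S × (Fin n → Z) =>
    1 / (Fintype.card H.S : ℝ) * H.hashOutput κ m a.1 a.2)
    (fun a : H.S × (Fin n → Z) =>
    1 / (Fintype.card H.S : ℝ) * H.hashOutput κ m' a.1 a.2) ≤ ε by
    have he := eavesdropper_protocolEncoder H ecc W w
    refine (congrArg₂ variationalDistance (funext fun a => ?_) (funext fun a => ?_)).trans_le hs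
    · exact congrArg (fun x : ℝ => 1 / (Fintype.card H.S : ℝ) * x) (he m a.1 a.2)
    · exact congrArg (fun x : ℝ => 1 / (Fintype.card H.S : ℝ) * x) (he m' a.1 a.2)
  have hS : (0 : ℝ) < Fintype.card H.S := by exact_mod_cast Fintype.card_pos
  rw [variationalDistance]
  simp_rw [Fintype.sum_prod_type]
  have : ∀ s z, |1 / (Fintype.card H.S : ℝ) * H.hashOutput κ m s z -
      1 / (Fintype.card H.S : ℝ) * H.hashOutput κ m' s z| ≤ (Fintype.card H.S : ℝ)⁻¹ *
      (|H.hashOutput κ m s z - (Fintype.card V : ℝ)⁻¹ * ∑ v, κ v z| +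
       |H.hashOutput κ m' s z - (Fintype.card V : ℝ)⁻¹ * ∑ v, κ v z|) := by
    intro s z
    rw [one_div, ← mul_sub, abs_mul, abs_of_pos (inv_pos.2 hS)]
    refine mul_le_mul_of_nonneg_left ?_ (by positivity)
    rw [abs_sub_comm (H.hashOutput κ m' s z)]
    exact abs_sub_le _ _ _
  calc _ ≤ 2⁻¹ * ∑ s, ∑ z, (Fintype.card H.S : ℝ)⁻¹ *
      (|H.hashOutput κ m s z - (Fintype.card V : ℝ)⁻¹ * ∑ v, κ v z| +
       |H.hashOutput κ m' s z - (Fintype.card V : ℝ)⁻¹ * ∑ v, κ v z|) := by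
        gcongr with s _ z _
        exact this s z
    _ = 2⁻¹ * (H.hashDistance κ m + H.hashDistance κ m') := by
        simp_rw [← Finset.mul_sum, Finset.sum_add_distrib, mul_add]
        rfl
    _ ≤ ε := by linarith

lemma hashDistance_le_of_const {V : Type} [Fintype V] (H : InvertibleHash V) {O : Type*}
    [Fintype O] (κ : V → O → ℝ) (hc : ∀ m m', H.hashDistance κ m = H.hashDistance κ m') (ε : ℝ)
    (h : (Fintype.card H.M : ℝ)⁻¹ * ∑ m, H.hashDistance κ m ≤ ε) (m : H.M) :
    H.hashDistance κ m ≤ ε := by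
  rwa [Finset.sum_congr rfl fun m' _ => hc m' m, Finset.sum_const, Finset.card_univ,
    nsmul_eq_mul, inv_mul_cancel_left₀ (by exact_mod_cast Fintype.card_ne_zero)] at h

end Secrecy

/-! ## Linear hash functions and translation covariant channels -/

lemma hashDistance_eq_of_isLinear {F : Type} [Field F] {Z : Type u} [Fintype Z] {n : ℕ}
    {V : Type} [Fintype V] [AddCommGroup V] [Module F V] (ecc : V →ₗ[F] (Fin n → F))
    (H : InvertibleHash V) (hH : H.IsLinear F) (K : Fin n → Channel F Z)
    (hK : ∀ i, IsTranslationCovariant (K i)) (m m' : H.M) :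
    H.hashDistance (fun v z => prodChannel K (ecc v) z) m =
      H.hashDistance (fun v z => prodChannel K (ecc v) z) m' := by
  obtain ⟨_, _, hl⟩ := hH
  rw [InvertibleHash.hashDistance, InvertibleHash.hashDistance]
  congr 1
  refine Finset.sum_congr rfl fun s _ => ?_
  obtain ⟨⟨v₀, h₀⟩⟩ := Fintype.card_pos_iff.1 (H.card_fiber_pos m s)
  obtain ⟨⟨v₁, h₁⟩⟩ := Fintype.card_pos_iff.1 (H.card_fiber_pos m' s)
  set d := v₁ - v₀ with hd
  have hext : ∀ v, H.ext (v + d) s = m' ↔ H.ext v s = m := by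
    intro v
    have e : H.ext (v + d) s = H.ext v s + (m' - m) := by
      rw [(hl s).map_add, hd, (hl s).map_sub, h₀, h₁]
    rw [e, ← eq_sub_iff_add_eq, sub_sub_cancel]
  choose π hπ using fun i => hK i (ecc d i)
  set σ : Equiv.Perm (Fin n → Z) := Equiv.piCongrRight π with hσ
  have hκ : ∀ v z, prodChannel K (ecc (v + d)) (σ z) = prodChannel K (ecc v) z := by
    intro v z
    rw [prodChannel_apply, prodChannel_apply]
    refine Finset.prod_congr rfl fun i _ => ?_
    rw [map_add, Pi.add_apply, hσ, Equiv.piCongrRight_apply, Pi.map_apply]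
    exact hπ i _ _
  have hcard : Fintype.card {v : V // H.ext v s = m'} = Fintype.card {v : V // H.ext v s = m} :=
    (Fintype.card_congr ((Equiv.addRight d).subtypeEquiv fun v => (hext v).symm)).symm
  have hQ : ∀ z, ∑ v, prodChannel K (ecc v) (σ z) = ∑ v, prodChannel K (ecc v) z := by
    intro z
    rw [← Equiv.sum_comp (Equiv.addRight d)]
    exact Finset.sum_congr rfl fun v _ => hκ v z
  rw [← Equiv.sum_comp σ fun z => |H.hashOutput (fun v z => prodChannel K (ecc v) z) m' s z - _|]
  refine Finset.sum_congr rfl fun z _ => ?_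
  rw [hQ, H.hashOutput_eq, H.hashOutput_eq, hcard]
  congr 3
  rw [← Equiv.sum_comp (Equiv.addRight d) fun v => if H.ext v s = m' then _ else (0 : ℝ)]
  refine Finset.sum_congr rfl fun v _ => ?_
  simp only [Equiv.coe_addRight, hext, hκ]

/-! ## Symmetric channels with at most three inputs -/

section SmallField

lemma isTranslationCovariant_of_one {p : ℕ} [NeZero p] {Z : Type u} [Fintype Z]
    (W : Channel (ZMod p) Z) (h : ∃ π : Equiv.Perm Z, ∀ x z, W (x + 1) (π z) = W x z) :
    IsTranslationCovariant W := by
  intro a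
  obtain ⟨n, rfl⟩ := ZMod.natCast_zmod_surjective a
  obtain ⟨π, hπ⟩ := h
  induction n with
  | zero => exact ⟨1, by simp⟩
  | succ n ih =>
    obtain ⟨σ, hσ⟩ := ih
    refine ⟨σ.trans π, fun x z => ?_⟩
    rw [Nat.cast_succ, ← add_assoc, Equiv.trans_apply, hπ, hσ]

lemma card_filter_column_two {Z : Type u} (A : Finset Z) (w : ZMod 2 → Z → ℝ)
    (hrow : ∀ x x' v, (A.filter fun z => w x z = v).card = (A.filter fun z => w x' z = v).card)
    (hcol : ∀ z ∈ A, ∀ z' ∈ A, ∃ π : Equiv.Perm (ZMod 2), ∀ x, w x z = w (π x) z') (a b : ℝ) :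
    (A.filter fun z => w 0 z = a ∧ w 1 z = b).card =
      (A.filter fun z => w 1 z = a ∧ w 0 z = b).card := by
  by_cases hex : ∃ z₁ ∈ A, (w 0 z₁ = a ∧ w 1 z₁ = b) ∨ (w 1 z₁ = a ∧ w 0 z₁ = b)
  · obtain ⟨z₁, hz₁, h₁⟩ := hex
    have hval : ∀ z ∈ A, (w 0 z = a ∧ w 1 z = b) ∨ (w 1 z = a ∧ w 0 z = b) := by
      intro z hz
      obtain ⟨π, hπ⟩ := hcol z hz z₁ hz₁
      have d : ∀ y : ZMod 2, y = 0 ∨ y = 1 := by decide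
      have i01 : π 0 ≠ π 1 := π.injective.ne (by decide)
      have e0 := hπ 0
      have e1 := hπ 1
      rcases d (π 0) with p0 | p0 <;> rcases d (π 1) with p1 | p1 <;> rw [p0] at e0 i01 <;>
        rw [p1] at e1 i01 <;> grind
    by_cases hab : a = b
    · subst hab
      simp_rw [and_comm]
    · rw [Finset.filter_congr (q := fun z => w 0 z = a) (by grind),
        Finset.filter_congr (p := fun z => w 1 z = a ∧ w 0 z = b) (q := fun z => w 1 z = a)
          (by grind)]
      exact hrow 0 1 a
  · push Not at hex
    rw [Finset.filter_false_of_mem, Finset.filter_false_of_mem]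
    · exact fun z hz => by have := hex z hz; tauto
    · exact fun z hz => by have := hex z hz; tauto

lemma card_filter_column_three {Z : Type u} (A : Finset Z) (w : ZMod 3 → Z → ℝ)
    (hrow : ∀ x x' v, (A.filter fun z => w x z = v).card = (A.filter fun z => w x' z = v).card)
    (hcol : ∀ z ∈ A, ∀ z' ∈ A, ∃ π : Equiv.Perm (ZMod 3), ∀ x, w x z = w (π x) z')
    (a b c : ℝ) :
    (A.filter fun z => w 0 z = a ∧ w 1 z = b ∧ w 2 z = c).card =
      (A.filter fun z => w 1 z = a ∧ w 2 z = b ∧ w 0 z = c).card := by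
  by_cases hex : ∃ z₁ ∈ A, (w 0 z₁ = a ∧ w 1 z₁ = b ∧ w 2 z₁ = c) ∨
      (w 1 z₁ = a ∧ w 2 z₁ = b ∧ w 0 z₁ = c)
  · obtain ⟨z₁, hz₁, h₁⟩ := hex
    have hval : ∀ z ∈ A, (w 0 z = a ∧ w 1 z = b ∧ w 2 z = c) ∨
        (w 0 z = b ∧ w 1 z = c ∧ w 2 z = a) ∨ (w 0 z = c ∧ w 1 z = a ∧ w 2 z = b) ∨
        (w 0 z = a ∧ w 1 z = c ∧ w 2 z = b) ∨ (w 0 z = b ∧ w 1 z = a ∧ w 2 z = c) ∨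
        (w 0 z = c ∧ w 1 z = b ∧ w 2 z = a) := by
      intro z hz
      obtain ⟨π, hπ⟩ := hcol z hz z₁ hz₁
      have d : ∀ y : ZMod 3, y = 0 ∨ y = 1 ∨ y = 2 := by decide
      have i01 : π 0 ≠ π 1 := π.injective.ne (by decide)
      have i02 : π 0 ≠ π 2 := π.injective.ne (by decide)
      have i12 : π 1 ≠ π 2 := π.injective.ne (by decide)
      have e0 := hπ 0
      have e1 := hπ 1
      have e2 := hπ 2
      rcases d (π 0) with p0 | p0 | p0 <;> rcases d (π 1) with p1 | p1 | p1 <;>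
        rcases d (π 2) with p2 | p2 | p2 <;> rw [p0] at e0 i01 i02 <;>
        rw [p1] at e1 i01 i12 <;> rw [p2] at e2 i02 i12 <;>
        first
          | exact absurd rfl i01
          | exact absurd rfl i02
          | exact absurd rfl i12
          | (rw [e0, e1, e2]; clear * - h₁; tauto)
    by_cases hab : a = b
    · subst hab
      by_cases hac : a = c
      · subst hac
        exact congrArg _ (Finset.filter_congr fun z _ => by tauto)
      · rw [Finset.filter_congr (q := fun z => w 2 z = c) (by grind),
          Finset.filter_congr (p := fun z => w 1 z = a ∧ w 2 z = a ∧ w 0 z = c)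
            (q := fun z => w 0 z = c) (by grind)]
        exact hrow 2 0 c
    by_cases hbc : b = c
    · subst hbc
      rw [Finset.filter_congr (q := fun z => w 0 z = a) (by grind),
        Finset.filter_congr (p := fun z => w 1 z = a ∧ w 2 z = b ∧ w 0 z = b)
          (q := fun z => w 1 z = a) (by grind)]
      exact hrow 0 1 a
    by_cases hac : a = c
    · subst hac
      rw [Finset.filter_congr (q := fun z => w 1 z = b) (by grind),
        Finset.filter_congr (p := fun z => w 1 z = a ∧ w 2 z = b ∧ w 0 z = a)
          (q := fun z => w 2 z = b) (by grind)]
      exact hrow 1 2 b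
    have ha : (A.filter fun z => w 0 z = a).card + (A.filter fun z => w 1 z = a).card +
        (A.filter fun z => w 2 z = a).card = A.card := by
      simp_rw [Finset.card_filter, ← Finset.sum_add_distrib]
      rw [Finset.card_eq_sum_ones]
      refine Finset.sum_congr rfl fun z hz => ?_
      have := hval z hz
      grind
    have hb : (A.filter fun z => w 0 z = b).card + (A.filter fun z => w 1 z = b).card +
        (A.filter fun z => w 2 z = b).card = A.card := by
      simp_rw [Finset.card_filter, ← Finset.sum_add_distrib]
      rw [Finset.card_eq_sum_ones]
      refine Finset.sum_congr rfl fun z hz => ?_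
      have := hval z hz
      grind
    have h1 : (A.filter fun z => w 0 z = a ∧ w 1 z = b ∧ w 2 z = c).card +
        (A.filter fun z => w 0 z = a ∧ w 1 z = c ∧ w 2 z = b).card =
        (A.filter fun z => w 0 z = a).card := by
      simp_rw [Finset.card_filter, ← Finset.sum_add_distrib]
      refine Finset.sum_congr rfl fun z hz => ?_
      have := hval z hz
      grind
    have h2 : (A.filter fun z => w 1 z = a ∧ w 2 z = b ∧ w 0 z = c).card +
        (A.filter fun z => w 0 z = a ∧ w 1 z = c ∧ w 2 z = b).card =
        (A.filter fun z => w 2 z = b).card := by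
      simp_rw [Finset.card_filter, ← Finset.sum_add_distrib]
      refine Finset.sum_congr rfl fun z hz => ?_
      have := hval z hz
      grind
    have r1 := hrow 1 0 a
    have r2 := hrow 2 0 a
    have r3 := hrow 1 0 b
    have r4 := hrow 2 0 b
    omega
  · push Not at hex
    rw [Finset.filter_false_of_mem, Finset.filter_false_of_mem]
    · exact fun z hz => by have := hex z hz; tauto
    · exact fun z hz => by have := hex z hz; tauto

/-- If within each class every column occurs as often as its translate, then there is a
permutation of the outputs that undoes the translation. -/
lemma exists_perm_of_card_eq {p : ℕ} {Z : Type u} [Fintype Z] (W : Channel (ZMod p) Z)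
    (r : Setoid Z)
    (h : ∀ z₀ (c : ZMod p → ℝ),
      ((Finset.univ.filter fun z => r z z₀).filter fun z => ∀ x, W x z = c x).card =
      ((Finset.univ.filter fun z => r z z₀).filter fun z => ∀ x, W (x + 1) z = c x).card) :
    ∃ π : Equiv.Perm Z, ∀ x z, W (x + 1) (π z) = W x z := by
  let f : Z → Quotient r × (ZMod p → ℝ) := fun z => (⟦z⟧, fun x => W x z)
  let g : Z → Quotient r × (ZMod p → ℝ) := fun z => (⟦z⟧, fun x => W (x + 1) z)
  have e : ∀ c, Nonempty ({z // f z = c} ≃ {z // g z = c}) := by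
    rintro ⟨q, c⟩
    induction q using Quotient.inductionOn with
    | h z₀ =>
      refine ⟨Fintype.equivOfCardEq ?_⟩
      rw [Fintype.card_subtype, Fintype.card_subtype]
      have := h z₀ c
      simp only [Finset.filter_filter] at this
      convert this using 4 with z z
      · rw [Prod.ext_iff, funext_iff]; exact and_congr Quotient.eq Iff.rfl
      · rw [Prod.ext_iff, funext_iff]; exact and_congr Quotient.eq Iff.rfl
  refine ⟨Equiv.ofFiberEquiv fun c => (e c).some, fun x z => ?_⟩
  have := Equiv.ofFiberEquiv_map (fun c => (e c).some) z
  exact congrFun (Prod.ext_iff.1 this).2 x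

lemma IsStronglySymmetricOn.card_row {X : Type v} {Z : Type u} [Fintype Z] {W : Channel X Z}
    {r : Setoid Z} {z₀ : Z} (h : IsStronglySymmetricOn W {z | r z z₀}) (x x' : X) (a : ℝ) :
    ((Finset.univ.filter fun z => r z z₀).filter fun z => W x z = a).card =
      ((Finset.univ.filter fun z => r z z₀).filter fun z => W x' z = a).card := by
  obtain ⟨π, hπ⟩ := h.1 x x'
  have e : ∀ y : X, ((Finset.univ.filter fun z => r z z₀).filter fun z => W y z = a).card =
      Fintype.card {z : ({z | r z z₀} : Set Z) // W y z = a} := by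
    intro y
    rw [Finset.filter_filter, ← Fintype.card_subtype]
    exact (Fintype.card_congr (Equiv.subtypeSubtypeEquivSubtypeInter (fun z => r z z₀)
      fun z => W y z = a)).symm
  rw [e, e]
  exact Fintype.card_congr (π.subtypeEquiv fun z => by rw [hπ])

lemma forall_zmod_three (P : ZMod 3 → Prop) : (∀ x, P x) ↔ P 0 ∧ P 1 ∧ P 2 :=
  ⟨fun h => ⟨h 0, h 1, h 2⟩, fun ⟨h0, h1, h2⟩ x => by
    have d : ∀ y : ZMod 3, y = 0 ∨ y = 1 ∨ y = 2 := by decide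
    rcases d x with rfl | rfl | rfl <;> assumption⟩

lemma IsSymmetric.isTranslationCovariant {p : ℕ} [Fact p.Prime] (hp : p ≤ 3) {Z : Type u}
    [Fintype Z] {W : Channel (ZMod p) Z} (hW : IsSymmetric W) : IsTranslationCovariant W := by
  have hp2 := (Fact.out : p.Prime).two_le
  have : NeZero p := ⟨by omega⟩
  refine isTranslationCovariant_of_one W ?_
  obtain ⟨r, hr⟩ := hW
  refine exists_perm_of_card_eq W r fun z₀ c => ?_
  have hcol : ∀ z ∈ Finset.univ.filter fun z => r z z₀, ∀ z' ∈ Finset.univ.filter fun z => r z z₀,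
      ∃ π : Equiv.Perm (ZMod p), ∀ x, W x z = W (π x) z' := fun z hz z' hz' =>
    (hr z₀).2 ⟨z, (Finset.mem_filter.1 hz).2⟩ ⟨z', (Finset.mem_filter.1 hz').2⟩
  obtain rfl | rfl : p = 2 ∨ p = 3 := by omega
  · have d : ∀ P : ZMod 2 → Prop, (∀ x, P x) ↔ P 0 ∧ P 1 := fun P => Fin.forall_fin_two
    have := card_filter_column_two _ (fun x z => W x z) (fun x x' a => (hr z₀).card_row x x' a)
      hcol (c 0) (c 1)
    simp only [d]
    exact this
  · have d := forall_zmod_three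
    have := card_filter_column_three _ (fun x z => W x z) (fun x x' a => (hr z₀).card_row x x' a)
      hcol (c 0) (c 1) (c 2)
    simp only [d]
    exact this

end SmallField

/-! ## Entropy and mutual information -/

section Information

variable {α : Type u} [Fintype α]

/-- Gibbs' inequality. -/
lemma sum_mul_logb_le (P : Distr α) (R : α → ℝ) (hR : ∀ a, 0 ≤ R a) (hR1 : ∑ a, R a ≤ 1)
    (h : ∀ a, 0 < P a → 0 < R a) :
    ∑ a, P a * Real.logb 2 (R a) ≤ ∑ a, P a * Real.logb 2 (P a) := by
  have hl : 0 < Real.log 2 := Real.log_pos (by norm_num)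
  have key : ∀ a, P a * Real.logb 2 (R a) - P a * Real.logb 2 (P a) ≤
      (R a - P a) / Real.log 2 := by
    intro a
    rw [Real.logb, Real.logb, ← mul_sub, ← sub_div, ← mul_div_assoc]
    refine div_le_div_of_nonneg_right ?_ hl.le
    rcases (distr_nonneg P a).eq_or_lt with h0 | h0
    · rw [← h0]; simpa using hR a
    · have hRa := h a h0
      rw [← Real.log_div hRa.ne' h0.ne']
      calc _ ≤ P a * (R a / P a - 1) :=
            mul_le_mul_of_nonneg_left (Real.log_le_sub_one_of_pos (div_pos hRa h0)) h0.le
        _ = _ := by field_simp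
  have := Finset.sum_le_sum fun a (_ : a ∈ Finset.univ) => key a
  rw [Finset.sum_sub_distrib, ← Finset.sum_div, Finset.sum_sub_distrib, distr_sum] at this
  have h2 : (∑ a, R a - 1) / Real.log 2 ≤ 0 := div_nonpos_of_nonpos_of_nonneg (by linarith) hl.le
  linarith

lemma nonempty_of_distr (P : Distr α) : Nonempty α := by
  by_contra h
  rw [not_nonempty_iff] at h
  have := distr_sum P
  simp at this

lemma entropy_nonneg (P : Distr α) : 0 ≤ entropy P := by
  rw [entropy, ← Finset.sum_neg_distrib]
  refine Finset.sum_nonneg fun a _ => ?_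
  have := Real.logb_nonpos (b := 2) (by norm_num) (distr_nonneg P a) (distr_le_one P a)
  have := mul_nonneg (distr_nonneg P a) (neg_nonneg.2 this)
  linarith

lemma entropy_le (P : Distr α) : entropy P ≤ Real.logb 2 (Fintype.card α) := by
  have : Nonempty α := nonempty_of_distr P
  have hc : (0 : ℝ) < Fintype.card α := by exact_mod_cast Fintype.card_pos
  have := sum_mul_logb_le P (fun _ => (Fintype.card α : ℝ)⁻¹) (fun _ => by positivity)
    (by simp) (fun _ _ => by positivity)
  rw [← Finset.sum_mul, distr_sum, Real.logb_inv] at this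
  rw [entropy]
  linarith

variable {X : Type v} {Z : Type w} [Fintype X] [Fintype Z]

lemma output_pos (P : Distr X) (W : Channel X Z) {x : X} {z : Z} (hx : 0 < P x)
    (hz : 0 < W x z) : 0 < output P W z := by
  rw [output_apply]
  exact (mul_pos hx hz).trans_le (Finset.single_le_sum (f := fun x => P x * W x z)
    (fun y _ => mul_nonneg (distr_nonneg _ _) (distr_nonneg _ _)) (Finset.mem_univ x))

/-- Mutual information as an average divergence from the output distribution. -/
lemma mutualInfo_eq_sum (P : Distr X) (W : Channel X Z) :
    mutualInfo P W = ∑ x, P x * (∑ z, W x z * Real.logb 2 (W x z) -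
      ∑ z, W x z * Real.logb 2 (output P W z)) := by
  simp only [mutualInfo, entropy, mul_sub, Finset.sum_sub_distrib, Finset.mul_sum, mul_neg,
    Finset.sum_neg_distrib]
  rw [Finset.sum_comm (f := fun x z => P x * (W x z * Real.logb 2 (output P W z)))]
  simp_rw [← mul_assoc, ← Finset.sum_mul, ← output_apply]
  ring

lemma mutualInfo_nonneg (P : Distr X) (W : Channel X Z) : 0 ≤ mutualInfo P W := by
  rw [mutualInfo_eq_sum]
  refine Finset.sum_nonneg fun x _ => ?_
  rcases (distr_nonneg P x).eq_or_lt with h | h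
  · rw [← h, zero_mul]
  · exact mul_nonneg h.le (sub_nonneg.2 (sum_mul_logb_le (W x) _ (distr_nonneg _)
      (distr_sum _).le fun z hz => output_pos P W h hz))

lemma mutualInfo_le (P : Distr X) (W : Channel X Z) :
    mutualInfo P W ≤ Real.logb 2 (Fintype.card Z) := by
  refine (sub_le_self _ ?_).trans (entropy_le (output P W))
  exact Finset.sum_nonneg fun x _ => mul_nonneg (distr_nonneg _ _) (entropy_nonneg _)

lemma uniformInfo_nonneg [Nonempty X] (W : Channel X Z) : 0 ≤ uniformInfo W :=
  mutualInfo_nonneg _ _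

lemma uniformInfo_le_shannonCapacity [Nonempty X] (W : Channel X Z) :
    uniformInfo W ≤ shannonCapacity W :=
  le_ciSup (f := fun P => mutualInfo P W)
    ⟨Real.logb 2 (Fintype.card Z), by rintro _ ⟨P, rfl⟩; exact mutualInfo_le P W⟩ (uniform X)

end Information

/-! ## Hashing with random permutations -/

section Perm

variable {V : Type} [Fintype V]

lemma sum_perm_symm_apply (g : V → ℝ) (v : V) :
    (Fintype.card V : ℝ) * ∑ σ : Equiv.Perm V, g (σ.symm v) =
      Fintype.card (Equiv.Perm V) * ∑ v, g v := by
  have h : ∀ v', ∑ σ : Equiv.Perm V, g (σ.symm v') = ∑ σ : Equiv.Perm V, g (σ.symm v) := by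
    intro v'
    rw [← Equiv.sum_comp (Equiv.mulLeft (Equiv.swap v v')) fun σ : Equiv.Perm V => g (σ.symm v')]
    refine Finset.sum_congr rfl fun σ _ => ?_
    congr 1
    rw [Equiv.symm_apply_eq]
    simp
  calc _ = ∑ v', ∑ σ : Equiv.Perm V, g (σ.symm v') := by
        rw [Finset.sum_congr rfl fun v' _ => h v', Finset.sum_const, Finset.card_univ,
          nsmul_eq_mul]
    _ = ∑ σ : Equiv.Perm V, ∑ v', g v' := by
        rw [Finset.sum_comm]
        exact Finset.sum_congr rfl fun σ _ => Equiv.sum_comp σ.symm g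
    _ = _ := by rw [Finset.sum_const, Finset.card_univ, nsmul_eq_mul]

lemma card_perm_collision {M R : Type} [Fintype M] [Nonempty M] [Fintype R] [Nonempty R]
    (e : V ≃ M × R) (v₀ v₁ : V) (h : v₀ ≠ v₁) :
    (Fintype.card {σ : Equiv.Perm V // (e (σ v₀)).1 = (e (σ v₁)).1} : ℝ) /
      Fintype.card (Equiv.Perm V) ≤ 1 / Fintype.card M := by
  set N : V → ℝ := fun v => (Fintype.card {σ : Equiv.Perm V // (e (σ v₀)).1 = (e (σ v)).1} : ℝ)
    with hN
  have hN' : ∀ v, N v = ∑ σ : Equiv.Perm V, if (e (σ v₀)).1 = (e (σ v)).1 then 1 else 0 := by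
    intro v
    rw [Finset.sum_boole]
    simp only [hN, Fintype.card_subtype]
  have hconst : ∀ v, v ≠ v₀ → N v = N v₁ := by
    intro v hv
    rw [hN', hN', ← Equiv.sum_comp (Equiv.mulRight (Equiv.swap v v₁))]
    refine Finset.sum_congr rfl fun σ _ => ?_
    simp [Equiv.swap_apply_of_ne_of_ne (Ne.symm hv) h]
  have hcol : ∀ σ : Equiv.Perm V, ∑ v, (if (e (σ v₀)).1 = (e (σ v)).1 then (1 : ℝ) else 0) =
      Fintype.card R := by
    intro σ
    rw [Equiv.sum_comp σ fun v => if (e (σ v₀)).1 = (e v).1 then (1 : ℝ) else 0,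
      ← Equiv.sum_comp e.symm]
    rw [Fintype.sum_prod_type]
    simp
  have hsum : ∑ v, N v = Fintype.card (Equiv.Perm V) * Fintype.card R := by
    simp_rw [hN']
    rw [Finset.sum_comm, Finset.sum_congr rfl fun σ _ => hcol σ, Finset.sum_const,
      Finset.card_univ, nsmul_eq_mul]
  have hN0 : N v₀ = Fintype.card (Equiv.Perm V) := by rw [hN']; simp
  rw [← Finset.sum_erase_add _ _ (Finset.mem_univ v₀), hN0,
    Finset.sum_congr rfl fun v hv => hconst v (Finset.ne_of_mem_erase hv), Finset.sum_const,
    Finset.card_erase_of_mem (Finset.mem_univ _), Finset.card_univ, nsmul_eq_mul] at hsum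
  have hcard : Fintype.card V = Fintype.card M * Fintype.card R := by
    rw [Fintype.card_congr e, Fintype.card_prod]
  have hV : 1 < Fintype.card V := Fintype.one_lt_card_iff.2 ⟨v₀, v₁, h⟩
  have hP : (0 : ℝ) < Fintype.card (Equiv.Perm V) := by exact_mod_cast Fintype.card_pos
  have hM : (1 : ℝ) ≤ Fintype.card M := by exact_mod_cast Fintype.card_pos
  rw [Nat.cast_sub hV.le, hcard] at hsum
  have hV' : (1 : ℝ) < Fintype.card M * Fintype.card R := by
    rw [hcard] at hV; exact_mod_cast hV
  push_cast at hsum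
  change N v₁ / _ ≤ _
  rw [div_le_div_iff₀ hP (by linarith), one_mul]
  refine le_of_mul_le_mul_left (a := (Fintype.card M * Fintype.card R - 1 : ℝ)) ?_ (by linarith)
  have : (Fintype.card M * Fintype.card R - 1 : ℝ) * (N v₁ * Fintype.card M) =
      Fintype.card M * (Fintype.card (Equiv.Perm V) * Fintype.card R -
        Fintype.card (Equiv.Perm V)) := by linear_combination (Fintype.card M : ℝ) * hsum
  rw [this]
  nlinarith [mul_nonneg hP.le (sub_nonneg.2 hM)]

/-- The hash family that applies a random permutation and then projects. -/
def permHash {M R : Type} [Fintype M] [Nonempty M] [Fintype R] [Nonempty R] (e : V ≃ M × R) :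
    InvertibleHash V where
  M := M
  S := Equiv.Perm V
  R := R
  ext v σ := (e (σ v)).1
  inv m σ r := σ.symm (e.symm (m, r))
  two_universal := card_perm_collision e
  inverter m σ v := by
    have h1 : ∀ r, σ.symm (e.symm (m, r)) = v ↔ (e (σ v)).1 = m ∧ (e (σ v)).2 = r := by
      intro r
      rw [Equiv.symm_apply_eq, Equiv.symm_apply_eq, eq_comm, Prod.ext_iff]
    have h2 : Fintype.card {v' : V // (e (σ v')).1 = m} = Fintype.card R := by
      have h3 : Fintype.card {v' : V // (e (σ v')).1 = m} =
          Fintype.card {a : M × R // a.1 = m} :=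
        Fintype.card_congr ((σ.trans e).subtypeEquiv fun v => Iff.rfl)
      rw [h3, Fintype.card_subtype, Finset.card_filter, Fintype.sum_prod_type]
      simp [apply_ite Finset.card]
    simp_rw [h1, h2]
    split_ifs with h
    · simp [h]
    · simp [h]

variable {M R : Type} [Fintype M] [Nonempty M] [Fintype R] [Nonempty R] (e : V ≃ M × R)

lemma permHash_hashDistance_eq {O : Type u} [Fintype O] (κ : V → O → ℝ)
    (m m' : (permHash e).M) :
    (permHash e).hashDistance κ m = (permHash e).hashDistance κ m' := by
  change M at m m'
  change (Fintype.card (Equiv.Perm V) : ℝ)⁻¹ * ∑ σ : Equiv.Perm V, ∑ z,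
    |(Fintype.card R : ℝ)⁻¹ * ∑ r, κ (σ.symm (e.symm (m, r))) z -
      (Fintype.card V : ℝ)⁻¹ * ∑ v, κ v z| =
    (Fintype.card (Equiv.Perm V) : ℝ)⁻¹ * ∑ σ : Equiv.Perm V, ∑ z,
    |(Fintype.card R : ℝ)⁻¹ * ∑ r, κ (σ.symm (e.symm (m', r))) z -
      (Fintype.card V : ℝ)⁻¹ * ∑ v, κ v z|
  refine congrArg _ ?_
  let τ : Equiv.Perm V := (e.trans ((Equiv.swap m m').prodCongr (Equiv.refl R))).trans e.symm
  rw [← Equiv.sum_comp (Equiv.mulLeft τ) fun σ : Equiv.Perm V => ∑ z,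
    |(Fintype.card R : ℝ)⁻¹ * ∑ r, κ (σ.symm (e.symm (m', r))) z -
      (Fintype.card V : ℝ)⁻¹ * ∑ v, κ v z|]
  refine Finset.sum_congr rfl fun σ _ => Finset.sum_congr rfl fun z _ => ?_
  refine congrArg (fun y : ℝ => |(Fintype.card R : ℝ)⁻¹ * y -
    (Fintype.card V : ℝ)⁻¹ * ∑ v, κ v z|)
    (Finset.sum_congr rfl fun r _ => congrArg (fun v => κ v z) ?_)
  symm
  rw [Equiv.symm_apply_eq]
  simp [τ]

lemma permHash_isCorrect {n : ℕ} {X : Type} [Fintype X] {Y : Type u} [Fintype Y]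
    (ecc : V → Fin n → X) (dec : (Fin n → Y) → V) (WR : Channel X Y) :
    (protocolEncoder (permHash e) ecc).IsCorrect (protocolDecoder (permHash e) ecc dec) WR
      (codeError ecc dec WR) := by
  intro m
  change M at m
  let κ : V → (Fin n → Y) → ℝ := fun v => prodChannel (fun _ => WR) (ecc v)
  let err : V → ℝ := fun v => ∑ y, κ v y * (if dec y ≠ v then 1 else 0)
  have hR : (0 : ℝ) < Fintype.card R := by exact_mod_cast Fintype.card_pos
  have hP : (0 : ℝ) < Fintype.card (Equiv.Perm V) := by exact_mod_cast Fintype.card_pos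
  have hV : (0 : ℝ) < Fintype.card V := by
    have : Nonempty V := ⟨e.symm (Classical.arbitrary _)⟩
    exact_mod_cast Fintype.card_pos
  suffices hs : ∑ σ : Equiv.Perm V, 1 / (Fintype.card (Equiv.Perm V) : ℝ) * ∑ y : Fin n → Y,
      (∑ r : R, uniform R r * κ (σ.symm (e.symm (m, r))) y) *
        (if (e (σ (dec y))).1 ≠ m then 1 else 0) ≤ codeError ecc dec WR by
    refine le_trans (le_of_eq ?_) hs
    refine Finset.sum_congr rfl fun σ _ => congrArg _ (Finset.sum_congr rfl fun y _ => ?_)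
    exact congrArg₂ _ (output_map (fun r : R => ecc (σ.symm (e.symm (m, r)))) (uniform R)
      (prodChannel fun _ => WR) y) rfl
  have h1 : ∀ σ : Equiv.Perm V, ∑ y : Fin n → Y,
      (∑ r : R, uniform R r * κ (σ.symm (e.symm (m, r))) y) *
        (if (e (σ (dec y))).1 ≠ m then 1 else 0) ≤
      (Fintype.card R : ℝ)⁻¹ * ∑ r, err (σ.symm (e.symm (m, r))) := by
    intro σ
    simp_rw [uniform_apply, ← Finset.mul_sum, mul_assoc]
    rw [← Finset.mul_sum]
    refine mul_le_mul_of_nonneg_left ?_ (by positivity)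
    simp_rw [err, Finset.sum_mul]
    rw [Finset.sum_comm]
    refine Finset.sum_le_sum fun r _ => Finset.sum_le_sum fun y _ => ?_
    refine mul_le_mul_of_nonneg_left ?_ (distr_nonneg _ _)
    by_cases h : dec y = σ.symm (e.symm (m, r))
    · simp [h]
    · simp only [h, ne_eq, not_false_eq_true, if_true]
      split_ifs <;> norm_num
  calc _ ≤ ∑ σ : Equiv.Perm V, 1 / (Fintype.card (Equiv.Perm V) : ℝ) *
        ((Fintype.card R : ℝ)⁻¹ * ∑ r, err (σ.symm (e.symm (m, r)))) := by
        gcongr with σ _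
        exact h1 σ
    _ = 1 / (Fintype.card (Equiv.Perm V) : ℝ) * ((Fintype.card R : ℝ)⁻¹ *
        ∑ r : R, ∑ σ : Equiv.Perm V, err (σ.symm (e.symm (m, r)))) := by
        rw [← Finset.mul_sum, ← Finset.mul_sum, Finset.sum_comm]
    _ = 1 / (Fintype.card V : ℝ) * ∑ v, err v := by
        have : ∀ r : R, ∑ σ : Equiv.Perm V, err (σ.symm (e.symm (m, r))) =
            Fintype.card (Equiv.Perm V) * (∑ v, err v) / Fintype.card V := by
          intro r
          rw [← sum_perm_symm_apply err (e.symm (m, r)), mul_div_cancel_left₀ _ hV.ne']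
        rw [Finset.sum_congr rfl fun r _ => this r, Finset.sum_const, Finset.card_univ,
          nsmul_eq_mul]
        field_simp
    _ = codeError ecc dec WR := by
        rw [Finset.mul_sum]; rfl

end Perm

/-! ## Achievability -/

section Secret

variable {n : ℕ} {X : Type} [Fintype X] {Q : Type u} {Z : Type v} [Fintype Z]

lemma SeededEncoder.IsSecret.mono {E : SeededEncoder n X} {W : Q → Channel X Z} {t : Q → ℕ}
    {ε ε' : ℝ} (h : E.IsSecret W t ε) (hε : ε ≤ ε') : E.IsSecret W t ε' :=
  fun w hw m m' => (h w hw m m').trans hε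

lemma SeededEncoder.isSecret_one (E : SeededEncoder n X) (W : Q → Channel X Z) (t : Q → ℕ) :
    E.IsSecret W t 1 := by
  intro w _ m m'
  have h : ∀ m : E.M, ∑ a : E.S × (Fin n → Z), 1 / (Fintype.card E.S : ℝ) *
      E.eavesdropper W w m a.1 a.2 = 1 := by
    intro m
    simp_rw [Fintype.sum_prod_type, ← Finset.mul_sum, distr_sum]
    simp
  have h0 : ∀ (m : E.M) (a : E.S × (Fin n → Z)), 0 ≤ 1 / (Fintype.card E.S : ℝ) *
      E.eavesdropper W w m a.1 a.2 := fun m a => mul_nonneg (by positivity) (distr_nonneg _ _)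
  rw [variationalDistance]
  have : ∑ a : E.S × (Fin n → Z), |1 / (Fintype.card E.S : ℝ) *
      E.eavesdropper W w m a.1 a.2 - 1 / (Fintype.card E.S : ℝ) *
      E.eavesdropper W w m' a.1 a.2| ≤ 1 + 1 := by
    refine le_trans ?_ (add_le_add (h m).le (h m').le)
    rw [← Finset.sum_add_distrib]
    refine Finset.sum_le_sum fun a _ => (abs_sub _ _).trans ?_
    rw [abs_of_nonneg (h0 _ _), abs_of_nonneg (h0 _ _)]
  linarith

lemma SeededEncoder.isSecret_zero (E : SeededEncoder n X) [Subsingleton E.M]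
    (W : Q → Channel X Z) (t : Q → ℕ) : E.IsSecret W t 0 := by
  intro w _ m m'
  rw [Subsingleton.elim m m']
  simp [variationalDistance]

end Secret

lemma exists_diagonal (P : ℕ → ℕ → Prop) (h : ∀ m, ∀ᶠ j in atTop, P m j) :
    ∃ φ : ℕ → ℕ, Tendsto φ atTop atTop ∧ ∀ᶠ j in atTop, P (φ j) j := by
  refine ⟨fun j => Nat.findGreatest (fun m => P m j) j, tendsto_atTop.2 fun m => ?_, ?_⟩
  · filter_upwards [h m, eventually_ge_atTop m] with j hj hm
    exact Nat.le_findGreatest hm hj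
  · filter_upwards [h 0] with j hj
    exact Nat.findGreatest_spec (P := fun m => P m j) (Nat.zero_le j) hj

section Achievability

variable {p : ℕ} [Fact p.Prime]

/-- A splitting of the message space of a code into a message of `min l k` symbols and the rest. -/
def codeSplitting (p : ℕ) [Fact p.Prime] (k l : ℕ) :
    (Fin k → ZMod p) ≃ (Fin (min l k) → ZMod p) × (Fin (k - min l k) → ZMod p) :=
  Fintype.equivOfCardEq (by
    rw [Fintype.card_prod, Fintype.card_fun, Fintype.card_fun, Fintype.card_fun,
      Fintype.card_fin, Fintype.card_fin, Fintype.card_fin, ← pow_add,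
      Nat.add_sub_cancel' (min_le_right l k)])

lemma logb_card_codeSplitting (k l : ℕ) (h : l ≤ k) :
    Real.logb 2 (Fintype.card (permHash (codeSplitting p k l)).M) = l * Real.logb 2 p := by
  change Real.logb 2 (Fintype.card (Fin (min l k) → ZMod p)) = _
  rw [min_eq_left h, Fintype.card_fun, ZMod.card, Fintype.card_fin]
  push_cast
  rw [Real.logb_pow]

/-- There are permutation hashes that are secret and whose message length is as large as
possible. -/
theorem exists_permHash_isSecret {Q : Type u} {Z : Type v} [Fintype Q] [Fintype Z]
    (W : Q → Channel (ZMod p) Z) (hW : ∀ q, IsSymmetric (W q)) (f : Q → ℝ) (n : ℕ → ℕ)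
    (t : ℕ → Q → ℕ) (hn : Tendsto n atTop atTop)
    (ht : ∀ q, Tendsto (fun j => (t j q : ℝ) / n j) atTop (𝓝 (f q)))
    (k : ℕ → ℕ) (ecc : ∀ j, (Fin (k j) → ZMod p) → Fin (n j) → ZMod p) :
    ∃ (l : ℕ → ℕ) (ε : ℕ → ℝ), Tendsto ε atTop (𝓝 0) ∧
      (∀ j, (protocolEncoder (permHash (codeSplitting p (k j) (l j))) (ecc j)).IsSecret W (t j)
        (ε j)) ∧
      Tendsto (fun j => (Real.logb 2 (Fintype.card (permHash (codeSplitting p (k j) (l j))).M)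
          - max 0 (Real.logb 2 (Fintype.card (Fin (k j) → ZMod p))
            - n j * ∑ q, f q * uniformInfo (W q))) / n j) atTop (𝓝 0) := by
  have hp : 0 < Real.logb 2 p := Real.logb_pos (by norm_num)
    (by exact_mod_cast (Fact.out : p.Prime).one_lt)
  have hV : ∀ k : ℕ, Real.logb 2 (Fintype.card (Fin k → ZMod p)) = k * Real.logb 2 p := by
    intro k
    rw [Fintype.card_fun, ZMod.card, Fintype.card_fin]
    push_cast
    rw [Real.logb_pow]
  let I : ℕ → ℝ := fun j => ∑ q, (t j q : ℝ) / n j * uniformInfo (W q)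
  have hI0 : ∀ j, 0 ≤ I j := fun j => Finset.sum_nonneg fun q _ =>
    mul_nonneg (by positivity) (uniformInfo_nonneg _)
  have hI : Tendsto I atTop (𝓝 (∑ q, f q * uniformInfo (W q))) :=
    tendsto_finsetSum _ fun q _ => (ht q).mul_const _
  let x : ℕ → ℕ → ℝ := fun m j => k j * Real.logb 2 p - n j * I j - n j * (1 / ((m : ℝ) + 1))
  let l : ℕ → ℕ → ℕ := fun m j => ⌊x m j / Real.logb 2 p⌋₊
  have hlk : ∀ m j, l m j ≤ k j := by
    intro m j
    refine Nat.floor_le_of_le ?_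
    rw [div_le_iff₀ hp]
    have : 0 ≤ n j * I j := mul_nonneg (Nat.cast_nonneg _) (hI0 j)
    have : 0 ≤ n j * (1 / ((m : ℝ) + 1)) := by positivity
    simp only [x]; linarith
  obtain ⟨φ, hφ, hP⟩ := exists_diagonal (fun m j =>
    (protocolEncoder (permHash (codeSplitting p (k j) (l m j))) (ecc j)).IsSecret W (t j)
      (1 / ((m : ℝ) + 1))) (by
    intro m
    obtain ⟨n₀, h₀⟩ := exists_average_hashDistance_le W hW (1 / ((m : ℝ) + 1)) (by positivity)
      (1 / ((m : ℝ) + 1)) (by positivity)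
    filter_upwards [hn.eventually_ge_atTop n₀] with j hj
    by_cases hl : l m j = 0
    · have : Subsingleton
          (protocolEncoder (permHash (codeSplitting p (k j) (l m j))) (ecc j)).M := by
        change Subsingleton (Fin (min (l m j) (k j)) → ZMod p)
        rw [hl, Nat.zero_min]
        infer_instance
      exact (SeededEncoder.isSecret_zero _ W (t j)).mono (by positivity)
    · refine isSecret_protocolEncoder _ _ _ _ _ fun w hw =>
        hashDistance_le_of_const _ _ (permHash_hashDistance_eq _ _) _
          (h₀ (n j) hj (t j) w hw _ (ecc j) _ ?_)
      rw [logb_card_codeSplitting _ _ (hlk m j), hV, ← le_div_iff₀ hp]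
      have hx : 0 ≤ x m j / Real.logb 2 p := by
        by_contra hx
        exact hl (Nat.floor_of_nonpos (not_le.1 hx).le)
      exact Nat.floor_le hx)
  refine ⟨fun j => l (φ j) j, fun j => if (protocolEncoder (permHash (codeSplitting p (k j)
    (l (φ j) j))) (ecc j)).IsSecret W (t j) (1 / ((φ j : ℝ) + 1)) then 1 / ((φ j : ℝ) + 1) else 1,
    ?_, fun j => ?_, ?_⟩
  · refine (tendsto_one_div_add_atTop_nhds_zero_nat.comp hφ).congr' ?_
    filter_upwards [hP] with j hj
    exact (if_pos hj).symm
  · dsimp only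
    split_ifs with h
    · exact h
    · exact SeededEncoder.isSecret_one _ _ _
  · have hb : Tendsto (fun j => Real.logb 2 p * ((n j : ℝ))⁻¹ +
        (|I j - ∑ q, f q * uniformInfo (W q)| + 1 / ((φ j : ℝ) + 1))) atTop (𝓝 0) := by
      have h1 : Tendsto (fun j => Real.logb 2 p * ((n j : ℝ))⁻¹) atTop (𝓝 (Real.logb 2 p * 0)) :=
        (tendsto_inv_atTop_nhds_zero_nat.comp hn).const_mul _
      have h2 : Tendsto (fun j => |I j - ∑ q, f q * uniformInfo (W q)|) atTop (𝓝 0) := by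
        rw [tendsto_iff_norm_sub_tendsto_zero] at hI
        exact hI
      have h3 := (tendsto_one_div_add_atTop_nhds_zero_nat (𝕜 := ℝ)).comp hφ
      simpa using h1.add (h2.add h3)
    refine squeeze_zero_norm' ?_ hb
    filter_upwards [hn.eventually_gt_atTop 0] with j hj
    have hj' : (0 : ℝ) < n j := by exact_mod_cast hj
    rw [logb_card_codeSplitting _ _ (hlk _ j), hV, Real.norm_eq_abs, abs_div, abs_of_pos hj',
      div_le_iff₀ hj']
    have hl1 : |(l (φ j) j : ℝ) * Real.logb 2 p - max 0 (x (φ j) j)| ≤ Real.logb 2 p := by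
      rcases le_total 0 (x (φ j) j) with h | h
      · have h1 := Nat.floor_le (div_nonneg h hp.le)
        have h2 := Nat.lt_floor_add_one (x (φ j) j / Real.logb 2 p)
        rw [le_div_iff₀ hp] at h1
        rw [div_lt_iff₀ hp] at h2
        rw [max_eq_right h, abs_le]
        constructor <;> linarith
      · have : l (φ j) j = 0 := Nat.floor_of_nonpos (div_nonpos_of_nonpos_of_nonneg h hp.le)
        rw [this, max_eq_left h]
        simpa using hp.le
    have hl2 : |max 0 (x (φ j) j) - max 0 (k j * Real.logb 2 p -
        n j * ∑ q, f q * uniformInfo (W q))| ≤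
        n j * |I j - ∑ q, f q * uniformInfo (W q)| + n j * (1 / ((φ j : ℝ) + 1)) := by
      refine (abs_max_sub_max_le_max _ _ _ _).trans ?_
      rw [sub_self, abs_zero, max_eq_right (abs_nonneg _)]
      have : x (φ j) j - (k j * Real.logb 2 p - n j * ∑ q, f q * uniformInfo (W q)) =
          -(n j * (I j - ∑ q, f q * uniformInfo (W q)) + n j * (1 / ((φ j : ℝ) + 1))) := by
        simp only [x]; ring
      rw [this, abs_neg]
      refine (abs_add_le _ _).trans (le_of_eq ?_)
      rw [abs_mul, abs_of_pos hj', abs_of_nonneg (a := (n j : ℝ) * (1 / ((φ j : ℝ) + 1)))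
        (by positivity)]
    refine (abs_sub_le _ (max 0 (x (φ j) j)) _).trans ((add_le_add hl1 hl2).trans (le_of_eq ?_))
    field_simp

end Achievability

/-! ## Mutual information: invariance, chain rule, Fano's inequality -/

section Chain

variable {M : Type u} [Fintype M]

lemma mutualInfo_eq_sum_sum {Z : Type v} [Fintype Z] (P : Distr M) (C : Channel M Z) :
    mutualInfo P C = ∑ m, ∑ z, P m * C m z *
      (Real.logb 2 (C m z) - Real.logb 2 (output P C z)) := by
  rw [mutualInfo_eq_sum]
  refine Finset.sum_congr rfl fun m _ => ?_
  rw [← Finset.sum_sub_distrib, Finset.mul_sum]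
  exact Finset.sum_congr rfl fun z _ => by ring

lemma mutualInfo_eq_of_injective {Z : Type v} {Z' : Type w} [Fintype Z] [Fintype Z']
    (P : Distr M) (C : Channel M Z) (C' : Channel M Z') (ι : Z → Z') (hι : Function.Injective ι)
    (h : ∀ m z, C' m (ι z) = C m z) (h0 : ∀ m, ∀ z' ∉ Set.range ι, C' m z' = 0) :
    mutualInfo P C = mutualInfo P C' := by
  have ho : ∀ z, output P C' (ι z) = output P C z := by
    intro z; simp_rw [output_apply, h]
  rw [mutualInfo_eq_sum_sum, mutualInfo_eq_sum_sum]
  refine Finset.sum_congr rfl fun m _ => ?_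
  refine Fintype.sum_of_injective ι hι _ _ (fun z' hz' => ?_) fun z => ?_
  · rw [h0 m z' hz']; simp
  · rw [h, ho]

lemma mutualInfo_eq_of_equiv {M' : Type w} [Fintype M'] {Z : Type v} [Fintype Z] (e : M' ≃ M)
    (P : Distr M) (C : Channel M Z) (P' : Distr M') (h : ∀ a, P' a = P (e a)) :
    mutualInfo P' (fun a => C (e a)) = mutualInfo P C := by
  have ho : ∀ z, output P' (fun a => C (e a)) z = output P C z := by
    intro z
    rw [output_apply, output_apply, ← Equiv.sum_comp e]
    exact Finset.sum_congr rfl fun a _ => by rw [h]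
  rw [mutualInfo_eq_sum_sum, mutualInfo_eq_sum_sum,
    ← Equiv.sum_comp e fun m => ∑ z, P m * C m z * (_ - _)]
  refine Finset.sum_congr rfl fun a _ => Finset.sum_congr rfl fun z _ => ?_
  rw [ho, h]

/-- The chain rule: if the output of `C i` consists of a part that does not depend on `i` and of
the output of the channel `K i` on an input `x`, then the mutual informations differ only by the
conditional mutual information of `K i`. -/
lemma mutualInfo_chain_rule {ι : Type*} {X : Type v} {A : Type w} {U O : Type*} [Fintype X]
    [Fintype A] [Fintype U] [Fintype O] (P : Distr M) (ρ : M → X → U → ℝ)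
    (hρ : ∀ m x u, 0 ≤ ρ m x u) (hρ1 : ∀ m, ∑ u, ∑ x, ρ m x u = 1) (K : ι → Channel X A)
    (e : O ≃ A × U) (C : ι → Channel M O)
    (hC : ∀ i m a u, C i m (e.symm (a, u)) = ∑ x, ρ m x u * K i x a) :
    ∃ (r : ℝ) (μ : Distr U) (P' : U → Distr M) (T : U → Channel M X),
      ∀ i, mutualInfo P (C i) = r + ∑ u, μ u * mutualInfo (P' u) ((T u).comp (K i)) := by
  have hM : Nonempty M := nonempty_of_distr P
  have hX : Nonempty X := by
    by_contra h
    rw [not_nonempty_iff] at h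
    have := hρ1 (Classical.arbitrary M)
    simp at this
  let ν : M → U → ℝ := fun m u => ∑ x, ρ m x u
  have hν : ∀ m u, 0 ≤ ν m u := fun m u => Finset.sum_nonneg fun x _ => hρ m x u
  have hμ : ∀ u, 0 ≤ ∑ m, P m * ν m u := fun u =>
    Finset.sum_nonneg fun m _ => mul_nonneg (distr_nonneg _ _) (hν m u)
  let μ : Distr U := ⟨fun u => ∑ m, P m * ν m u, hμ, by
    rw [Finset.sum_comm]
    simp_rw [← Finset.mul_sum, ν, hρ1, mul_one]
    exact distr_sum P⟩
  have hμe : ∀ u, μ u = ∑ m, P m * ν m u := fun u => rfl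
  let P' : U → Distr M := fun u => if h : μ u = 0 then P else
    ⟨fun m => P m * ν m u / μ u, fun m => div_nonneg (mul_nonneg (distr_nonneg _ _) (hν m u))
      (distr_nonneg _ _), by rw [← Finset.sum_div, ← hμe, div_self h]⟩
  let T : U → Channel M X := fun u m => if h : ν m u = 0 then uniform X else
    ⟨fun x => ρ m x u / ν m u, fun x => div_nonneg (hρ m x u) (hν m u), by
      rw [← Finset.sum_div]; exact div_self h⟩
  have hP' : ∀ m u, μ u * P' u m = P m * ν m u := by
    intro m u
    by_cases h : μ u = 0
    · have h' := h
      rw [hμe, Finset.sum_eq_zero_iff_of_nonneg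
        (fun m _ => mul_nonneg (distr_nonneg _ _) (hν m u))] at h'
      rw [h, zero_mul, h' m (Finset.mem_univ m)]
    · simp only [P', dif_neg h]
      exact mul_div_cancel₀ _ h
  have hT : ∀ m u x, ν m u * T u m x = ρ m x u := by
    intro m u x
    by_cases h : ν m u = 0
    · have h' : ∑ x, ρ m x u = 0 := h
      rw [Finset.sum_eq_zero_iff_of_nonneg fun x _ => hρ m x u] at h'
      rw [h, zero_mul, h' x (Finset.mem_univ x)]
    · simp only [T, dif_neg h]
      exact mul_div_cancel₀ _ h
  have hTK : ∀ i m u a, ν m u * (T u).comp (K i) m a = C i m (e.symm (a, u)) := by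
    intro i m u a
    rw [hC, Channel.comp, output_apply, Finset.mul_sum]
    exact Finset.sum_congr rfl fun x _ => by rw [← mul_assoc, hT]
  have hout : ∀ i u a, μ u * output (P' u) ((T u).comp (K i)) a =
      output P (C i) (e.symm (a, u)) := by
    intro i u a
    rw [output_apply, output_apply, Finset.mul_sum]
    refine Finset.sum_congr rfl fun m _ => ?_
    rw [← mul_assoc, hP', mul_assoc, hTK]
  have hCsum : ∀ i m u, ∑ a, C i m (e.symm (a, u)) = ν m u := by
    intro i m u
    simp_rw [← hTK, ← Finset.mul_sum, distr_sum, mul_one]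
  refine ⟨∑ m, ∑ u, P m * ν m u * (Real.logb 2 (ν m u) - Real.logb 2 (μ u)), μ, P', T,
    fun i => ?_⟩
  have key : ∀ m u a, P m * C i m (e.symm (a, u)) * (Real.logb 2 (C i m (e.symm (a, u))) -
      Real.logb 2 (output P (C i) (e.symm (a, u)))) =
      P m * C i m (e.symm (a, u)) * (Real.logb 2 (ν m u) - Real.logb 2 (μ u)) +
      μ u * (P' u m * (T u).comp (K i) m a * (Real.logb 2 ((T u).comp (K i) m a) -
        Real.logb 2 (output (P' u) ((T u).comp (K i)) a))) := by
    intro m u a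
    have e1 : μ u * (P' u m * (T u).comp (K i) m a * (Real.logb 2 ((T u).comp (K i) m a) -
        Real.logb 2 (output (P' u) ((T u).comp (K i)) a))) =
        P m * C i m (e.symm (a, u)) * (Real.logb 2 ((T u).comp (K i) m a) -
        Real.logb 2 (output (P' u) ((T u).comp (K i)) a)) := by
      rw [← mul_assoc, ← mul_assoc, hP', mul_assoc (P m), hTK]
    rw [e1]
    by_cases h0 : P m * C i m (e.symm (a, u)) = 0
    · simp [h0]
    · have hp : P m ≠ 0 := left_ne_zero_of_mul h0
      have hc : C i m (e.symm (a, u)) ≠ 0 := right_ne_zero_of_mul h0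
      have ho : output P (C i) (e.symm (a, u)) ≠ 0 :=
        (output_pos P (C i) (lt_of_le_of_ne (distr_nonneg _ _) (Ne.symm hp))
          (lt_of_le_of_ne (distr_nonneg _ _) (Ne.symm hc))).ne'
      rw [← hTK] at hc
      rw [← hout] at ho
      rw [← hTK i, ← hout i, Real.logb_mul (left_ne_zero_of_mul hc) (right_ne_zero_of_mul hc),
        Real.logb_mul (left_ne_zero_of_mul ho) (right_ne_zero_of_mul ho)]
      ring
  rw [mutualInfo_eq_sum_sum]
  calc _ = ∑ m, ∑ u, ∑ a, P m * C i m (e.symm (a, u)) *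
        (Real.logb 2 (C i m (e.symm (a, u))) -
        Real.logb 2 (output P (C i) (e.symm (a, u)))) := by
        refine Finset.sum_congr rfl fun m _ => ?_
        rw [← Equiv.sum_comp e.symm, Fintype.sum_prod_type, Finset.sum_comm]
    _ = ∑ m, ∑ u, (P m * ν m u * (Real.logb 2 (ν m u) - Real.logb 2 (μ u)) +
        μ u * ∑ a, P' u m * (T u).comp (K i) m a * (Real.logb 2 ((T u).comp (K i) m a) -
        Real.logb 2 (output (P' u) ((T u).comp (K i)) a))) := by
        refine Finset.sum_congr rfl fun m _ => Finset.sum_congr rfl fun u _ => ?_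
        rw [Finset.sum_congr rfl fun a _ => key m u a, Finset.sum_add_distrib, ← Finset.sum_mul,
          ← Finset.mul_sum, hCsum, ← Finset.mul_sum]
    _ = _ := by
        simp_rw [Finset.sum_add_distrib]
        congr 1
        rw [Finset.sum_comm]
        refine Finset.sum_congr rfl fun u _ => ?_
        rw [← Finset.mul_sum, ← mutualInfo_eq_sum_sum]

variable [Nonempty M]

/-- Fano's inequality. -/
lemma le_mutualInfo_of_decoder {Y : Type v} [Fintype Y] (C : Channel M Y) (d : Y → M) :
    Real.logb 2 (Fintype.card M) - 1 - Real.logb 2 (Fintype.card M) *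
      ((Fintype.card M : ℝ)⁻¹ * ∑ m, ∑ y, C m y * (if d y ≠ m then 1 else 0)) ≤
      mutualInfo (uniform M) C := by
  have hM : (0 : ℝ) < Fintype.card M := by exact_mod_cast Fintype.card_pos
  let p : Distr (M × Y) := ⟨fun a => uniform M a.1 * C a.1 a.2,
    fun a => mul_nonneg (distr_nonneg _ _) (distr_nonneg _ _), by
      rw [Fintype.sum_prod_type]
      simp_rw [← Finset.mul_sum, distr_sum, mul_one]
      exact distr_sum _⟩
  let D : M × Y → ℝ := fun a => 2⁻¹ * (if d a.2 = a.1 then 1 else 0) + 2⁻¹ * (Fintype.card M : ℝ)⁻¹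
  have hD : ∀ a, 0 < D a := fun a => by
    simp only [D]; split_ifs <;> positivity
  have hp : ∀ a, p a = uniform M a.1 * C a.1 a.2 := fun a => rfl
  have ho : ∀ a, 0 < p a → 0 < output (uniform M) C a.2 := by
    intro a ha
    rw [hp] at ha
    exact output_pos _ _ (pos_of_mul_pos_left ha (distr_nonneg _ _))
      (pos_of_mul_pos_right ha (distr_nonneg _ _))
  have hG := sum_mul_logb_le p (fun a => output (uniform M) C a.2 * D a)
    (fun a => mul_nonneg (distr_nonneg _ _) (hD a).le) (by
      rw [Fintype.sum_prod_type, Finset.sum_comm]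
      simp_rw [← Finset.mul_sum, D, Finset.sum_add_distrib, ← Finset.mul_sum]
      simp only [Finset.sum_ite_eq, Finset.mem_univ, if_true, Finset.sum_const, Finset.card_univ,
        nsmul_eq_mul, mul_inv_cancel₀ hM.ne']
      rw [← Finset.sum_mul, distr_sum]
      norm_num) (fun a ha => mul_pos (ho a ha) (hD a))
  have key : ∀ a, p a * Real.logb 2 (p a) - p a * Real.logb 2 (output (uniform M) C a.2 * D a) ≤
      p a * (Real.logb 2 (C a.1 a.2) - Real.logb 2 (output (uniform M) C a.2)) -
      p a * (Real.logb 2 (Fintype.card M) - 1) + Real.logb 2 (Fintype.card M) *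
        (p a * (if d a.2 ≠ a.1 then 1 else 0)) := by
    intro a
    rcases (distr_nonneg p a).eq_or_lt with h0 | h0
    · rw [← h0]; simp
    · have h1 := h0
      rw [hp] at h1
      have hu := pos_of_mul_pos_left h1 (distr_nonneg _ _)
      have hc := pos_of_mul_pos_right h1 (distr_nonneg _ _)
      have e1 : Real.logb 2 (p a) = Real.logb 2 (C a.1 a.2) - Real.logb 2 (Fintype.card M) := by
        rw [hp, Real.logb_mul hu.ne' hc.ne', uniform_apply, Real.logb_inv]; ring
      have e2 : -1 - Real.logb 2 (Fintype.card M) * (if d a.2 ≠ a.1 then 1 else 0) ≤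
          Real.logb 2 (D a) := by
        by_cases h : d a.2 = a.1
        · simp only [h, ne_eq, not_true_eq_false, if_false, mul_zero, sub_zero]
          calc (-1 : ℝ) = Real.logb 2 2⁻¹ := by
                rw [Real.logb_inv, Real.logb_self_eq_one (by norm_num)]
            _ ≤ _ := by
                refine Real.logb_le_logb_of_le (by norm_num) (by norm_num) ?_
                simp only [D, h, if_true]
                have : 0 < 2⁻¹ * (Fintype.card M : ℝ)⁻¹ := by positivity
                linarith
        · simp only [h, ne_eq, not_false_eq_true, if_true, mul_one, D, if_false, mul_zero, zero_add]
          rw [Real.logb_mul (by norm_num) (by positivity), Real.logb_inv, Real.logb_inv,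
            Real.logb_self_eq_one (by norm_num)]
          linarith
      rw [Real.logb_mul (ho a h0).ne' (hD a).ne', e1]
      have := mul_le_mul_of_nonneg_left e2 h0.le
      linarith
  have hs := Finset.sum_le_sum fun a (_ : a ∈ Finset.univ) => key a
  rw [Finset.sum_sub_distrib, Finset.sum_add_distrib, Finset.sum_sub_distrib, ← Finset.sum_mul,
    distr_sum, ← Finset.mul_sum] at hs
  have e3 : ∑ a, p a * (Real.logb 2 (C a.1 a.2) - Real.logb 2 (output (uniform M) C a.2)) =
      mutualInfo (uniform M) C := by
    rw [mutualInfo_eq_sum_sum, Fintype.sum_prod_type]; rfl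
  have e4 : ∑ a, p a * (if d a.2 ≠ a.1 then (1 : ℝ) else 0) =
      (Fintype.card M : ℝ)⁻¹ * ∑ m, ∑ y, C m y * (if d y ≠ m then 1 else 0) := by
    rw [Fintype.sum_prod_type, Finset.mul_sum]
    refine Finset.sum_congr rfl fun m _ => ?_
    rw [Finset.mul_sum]
    refine Finset.sum_congr rfl fun y _ => ?_
    rw [hp, uniform_apply, mul_assoc]
  rw [e3, e4] at hs
  linarith

/-- The information leaked about a uniform message is small if the outputs for different messages
are close to each other. -/
lemma mutualInfo_le_of_close {Z : Type v} [Fintype Z] (C : Channel M Z) :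
    mutualInfo (uniform M) C ≤ (2 + Real.logb 2 (Fintype.card M)) *
      ((Fintype.card M : ℝ)⁻¹ * ∑ m, (Fintype.card M : ℝ)⁻¹ * ∑ m', ∑ z, |C m z - C m' z|) := by
  have hM : (0 : ℝ) < Fintype.card M := by exact_mod_cast Fintype.card_pos
  have hM1 : (1 : ℝ) ≤ Fintype.card M := by exact_mod_cast Fintype.card_pos
  have hlM : 0 ≤ Real.logb 2 (Fintype.card M) := Real.logb_nonneg (by norm_num) hM1
  have hl2 : 2⁻¹ ≤ Real.log 2 := by linarith [Real.log_two_gt_d9]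
  have hl : 0 < Real.log 2 := by linarith
  set o := output (uniform M) C with ho
  have hle : ∀ m z, C m z ≤ Fintype.card M * o z := by
    intro m z
    rw [ho, output_uniform_apply, mul_inv_cancel_left₀ hM.ne']
    exact Finset.single_le_sum (f := fun x => C x z) (fun y _ => distr_nonneg _ _)
      (Finset.mem_univ m)
  have key : ∀ m z, C m z * (Real.logb 2 (C m z) - Real.logb 2 (o z)) ≤
      (2 + Real.logb 2 (Fintype.card M)) * |C m z - o z| := by
    intro m z
    rcases (distr_nonneg (C m) z).eq_or_lt with h0 | h0
    · rw [← h0, zero_mul]; positivity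
    · have hoz : 0 < o z := pos_of_mul_pos_right (h0.trans_le (hle m z)) hM.le
      rw [← Real.logb_div h0.ne' hoz.ne']
      rcases le_total (C m z) (o z) with h | h
      · refine le_trans (mul_nonpos_of_nonneg_of_nonpos h0.le ?_) (by positivity)
        exact Real.logb_nonpos (by norm_num) (by positivity) ((div_le_one hoz).2 h)
      · rw [abs_of_nonneg (sub_nonneg.2 h)]
        have a1 : Real.logb 2 (C m z / o z) ≤ Real.logb 2 (Fintype.card M) :=
          Real.logb_le_logb_of_le (by norm_num) (by positivity)
            ((div_le_iff₀ hoz).2 (hle m z))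
        have a2 : o z * Real.logb 2 (C m z / o z) ≤ 2 * (C m z - o z) := by
          rw [Real.logb, mul_div_assoc', div_le_iff₀ hl]
          have := Real.log_le_sub_one_of_pos (div_pos h0 hoz)
          calc _ ≤ o z * (C m z / o z - 1) := mul_le_mul_of_nonneg_left this hoz.le
            _ = (C m z - o z) * 1 := by field_simp
            _ ≤ (C m z - o z) * (2 * Real.log 2) :=
                mul_le_mul_of_nonneg_left (by linarith) (sub_nonneg.2 h)
            _ = _ := by ring
        have a3 := mul_le_mul_of_nonneg_left a1 (sub_nonneg.2 h)
        linarith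
  have hdiff : ∀ m z, |C m z - o z| ≤ (Fintype.card M : ℝ)⁻¹ * ∑ m', |C m z - C m' z| := by
    intro m z
    have : C m z - o z = (Fintype.card M : ℝ)⁻¹ * ∑ m', (C m z - C m' z) := by
      rw [ho, output_uniform_apply, Finset.sum_sub_distrib]
      simp only [Finset.sum_const, Finset.card_univ, nsmul_eq_mul]
      field_simp
    rw [this, abs_mul, abs_of_pos (inv_pos.2 hM)]
    exact mul_le_mul_of_nonneg_left (Finset.abs_sum_le_sum_abs _ _) (by positivity)
  rw [mutualInfo_eq_sum_sum, Finset.mul_sum, Finset.mul_sum]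
  refine Finset.sum_le_sum fun m _ => ?_
  calc _ = (Fintype.card M : ℝ)⁻¹ * ∑ z, C m z * (Real.logb 2 (C m z) - Real.logb 2 (o z)) := by
        rw [Finset.mul_sum]
        exact Finset.sum_congr rfl fun z _ => by rw [uniform_apply]; ring
    _ ≤ (Fintype.card M : ℝ)⁻¹ * ∑ z, (2 + Real.logb 2 (Fintype.card M)) *
        ((Fintype.card M : ℝ)⁻¹ * ∑ m', |C m z - C m' z|) := by
        refine mul_le_mul_of_nonneg_left (Finset.sum_le_sum fun z _ => ?_) (by positivity)
        exact (key m z).trans (mul_le_mul_of_nonneg_left (hdiff m z) (by positivity))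
    _ = _ := by
        simp_rw [← Finset.mul_sum]
        rw [Finset.sum_comm]
        ring

end Chain

/-! ## The information obtained through a product of channels -/

section Info

variable {n : ℕ} {X : Type} [Fintype X] {A : Type u} [Fintype A]

/-- Mutual information between a uniform message and the outputs of the channels `K i`, given the
seed. -/
def SeededEncoder.info (E : SeededEncoder n X) (K : Fin n → Channel X A) : ℝ :=
  (Fintype.card E.S : ℝ)⁻¹ * ∑ s, mutualInfo (uniform E.M)
    (Channel.comp (fun m => E.enc m s) (prodChannel K))

lemma mutualInfo_prodChannel_update {M : Type v} [Fintype M] (P : Distr M)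
    (T : Channel M (Fin n → X)) {ι : Type w} (K : ι → Channel X A) (w : Fin n → Channel X A)
    (i : Fin n) :
    ∃ (r : ℝ) (μ : Distr ({j // j ≠ i} → A)) (P' : ({j // j ≠ i} → A) → Distr M)
      (T' : ({j // j ≠ i} → A) → Channel M X),
      ∀ a, mutualInfo P (T.comp (prodChannel (Function.update w i (K a)))) =
        r + ∑ u, μ u * mutualInfo (P' u) ((T' u).comp (K a)) := by
  let ρ : M → X → ({j // j ≠ i} → A) → ℝ := fun m x u =>
    ∑ ξ : Fin n → X, if ξ i = x then T m ξ * ∏ j : {j // j ≠ i}, w j (ξ j) (u j) else 0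
  have hnn : ∀ (ξ : Fin n → X) (u : {j // j ≠ i} → A),
      0 ≤ ∏ j : {j // j ≠ i}, w j (ξ j) (u j) := fun ξ u =>
    Finset.prod_nonneg fun j _ => distr_nonneg _ _
  refine mutualInfo_chain_rule P ρ (fun m x u => ?_) (fun m => ?_) K (Equiv.funSplitAt i A)
    (fun a => T.comp (prodChannel (Function.update w i (K a)))) fun a m b u => ?_
  · refine Finset.sum_nonneg fun ξ _ => ?_
    split_ifs
    exacts [mul_nonneg (distr_nonneg _ _) (hnn ξ u), le_rfl]
  · have h1 : ∀ u, ∑ x, ρ m x u = ∑ ξ, T m ξ * ∏ j : {j // j ≠ i}, w j (ξ j) (u j) := by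
      intro u
      rw [Finset.sum_comm]
      simp
    have h2 : ∀ ξ : Fin n → X, ∑ u : {j // j ≠ i} → A,
        ∏ j : {j // j ≠ i}, w j (ξ j) (u j) = 1 := by
      intro ξ
      rw [← Fintype.piFinset_univ,
        ← Finset.prod_univ_sum (fun _ => Finset.univ) fun (j : {j // j ≠ i}) a => w j (ξ j) a]
      simp
    simp_rw [h1]
    rw [Finset.sum_comm]
    simp_rw [← Finset.mul_sum, h2, mul_one, distr_sum]
  · rw [Channel.comp, output_apply]
    simp_rw [ρ, Finset.sum_mul]
    rw [Finset.sum_comm]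
    refine Finset.sum_congr rfl fun ξ _ => ?_
    rw [Finset.sum_eq_single (ξ i) (fun x _ hx => by rw [if_neg (Ne.symm hx), zero_mul])
      (fun h => absurd (Finset.mem_univ _) h), if_pos rfl, prodChannel_apply,
      Fintype.prod_eq_mul_prod_subtype_ne _ i, Function.update_self,
      Finset.prod_congr rfl (g := fun j : {j // j ≠ i} => w j (ξ j) (u j))]
    · have : (Equiv.funSplitAt i A).symm (b, u) i = b := by simp
      rw [this]; ring
    · intro j _
      have : (Equiv.funSplitAt i A).symm (b, u) j = u j := by simp [j.2]
      rw [this, Function.update_of_ne j.2]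

/-- A linear inequality between mutual informations that holds for a single use of the channels
holds for replacing one factor in a product of channels. -/
lemma SeededEncoder.sum_mul_info_update_le (E : SeededEncoder n X) {ι : Type w} [Fintype ι]
    (K : ι → Channel X A) (c : ι → ℝ) (hc : ∑ a, c a = 0) (V : ℝ)
    (h : ∀ (P : Distr E.M) (T : Channel E.M X), ∑ a, c a * mutualInfo P (T.comp (K a)) ≤ V)
    (w : Fin n → Channel X A) (i : Fin n) :
    ∑ a, c a * E.info (Function.update w i (K a)) ≤ V := by
  have hS : (0 : ℝ) < Fintype.card E.S := by exact_mod_cast Fintype.card_pos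
  have key : ∀ s, ∑ a, c a * mutualInfo (uniform E.M) (Channel.comp (fun m => E.enc m s)
      (prodChannel (Function.update w i (K a)))) ≤ V := by
    intro s
    obtain ⟨r, μ, P', T', hr⟩ := mutualInfo_prodChannel_update (uniform E.M)
      (fun m => E.enc m s) K w i
    simp_rw [hr, mul_add, Finset.sum_add_distrib]
    rw [← Finset.sum_mul, hc, zero_mul, zero_add]
    simp_rw [Finset.mul_sum]
    rw [Finset.sum_comm]
    calc _ = ∑ u, μ u * ∑ a, c a * mutualInfo (P' u) ((T' u).comp (K a)) := by
          refine Finset.sum_congr rfl fun u _ => ?_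
          rw [Finset.mul_sum]
          exact Finset.sum_congr rfl fun a _ => by ring
      _ ≤ ∑ u, μ u * V :=
          Finset.sum_le_sum fun u _ => mul_le_mul_of_nonneg_left (h _ _) (distr_nonneg _ _)
      _ = V := by rw [← Finset.sum_mul, distr_sum, one_mul]
  calc _ = (Fintype.card E.S : ℝ)⁻¹ * ∑ s, ∑ a, c a * mutualInfo (uniform E.M)
        (Channel.comp (fun m => E.enc m s) (prodChannel (Function.update w i (K a)))) := by
        rw [Finset.sum_comm, Finset.mul_sum]
        refine Finset.sum_congr rfl fun a _ => ?_
        rw [SeededEncoder.info, ← Finset.mul_sum]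
        ring
    _ ≤ (Fintype.card E.S : ℝ)⁻¹ * ∑ _s : E.S, V :=
        mul_le_mul_of_nonneg_left (Finset.sum_le_sum fun s _ => key s) (by positivity)
    _ = V := by
        rw [Finset.sum_const, Finset.card_univ, nsmul_eq_mul, inv_mul_cancel_left₀ hS.ne']

lemma SeededEncoder.info_update_le (E : SeededEncoder n X) (K K' : Channel X A)
    (w : Fin n → Channel X A) (i : Fin n) :
    E.info (Function.update w i K) ≤
      E.info (Function.update w i K') + Real.logb 2 (Fintype.card A) := by
  have := E.sum_mul_info_update_le (fun b : Bool => if b then K else K')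
    (fun b => if b then 1 else -1) (by simp) (Real.logb 2 (Fintype.card A)) (fun P T => by
      simp only [Fintype.sum_bool, if_true, Bool.false_eq_true, if_false]
      linarith [mutualInfo_nonneg P (T.comp K'), mutualInfo_le P (T.comp K)]) w i
  simp only [Fintype.sum_bool, if_true, Bool.false_eq_true, if_false] at this
  linarith

lemma SeededEncoder.info_eq_of_injective (E : SeededEncoder n X) {B : Type v} [Fintype B]
    (K : Fin n → Channel X A) (K' : Fin n → Channel X B) (ι : A → B)
    (hι : Function.Injective ι) (h : ∀ i x a, K' i x (ι a) = K i x a)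
    (h0 : ∀ i x, ∀ b ∉ Set.range ι, K' i x b = 0) : E.info K = E.info K' := by
  rw [SeededEncoder.info, SeededEncoder.info]
  congr 1
  refine Finset.sum_congr rfl fun s _ => ?_
  refine mutualInfo_eq_of_injective _ _ _ (fun z i => ι (z i))
    (fun z z' hz => funext fun i => hι (congrFun hz i)) (fun m z => ?_) fun m z' hz' => ?_
  · simp_rw [Channel.comp, output_apply, prodChannel_apply, h]
  · obtain ⟨i, hi⟩ : ∃ i, z' i ∉ Set.range ι := by
      by_contra! hall
      choose z hz using hall
      exact hz' ⟨z, funext hz⟩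
    simp_rw [Channel.comp, output_apply, prodChannel_apply]
    refine Finset.sum_eq_zero fun ξ _ => ?_
    rw [Finset.prod_eq_zero (Finset.mem_univ i) (h0 i _ _ hi), mul_zero]

lemma SeededEncoder.le_info_of_isCorrect (E : SeededEncoder n X) {Y : Type v} [Fintype Y]
    (dec : (Fin n → Y) → E.S → E.M) (WR : Channel X Y) (ε : ℝ) (h : E.IsCorrect dec WR ε) :
    (1 - ε) * Real.logb 2 (Fintype.card E.M) - 1 ≤ E.info fun _ => WR := by
  have hS : (0 : ℝ) < Fintype.card E.S := by exact_mod_cast Fintype.card_pos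
  have hM : (0 : ℝ) < Fintype.card E.M := by exact_mod_cast Fintype.card_pos
  have hM1 : (1 : ℝ) ≤ Fintype.card E.M := by exact_mod_cast Fintype.card_pos
  set lam := Real.logb 2 (Fintype.card E.M) with hlam
  have hl : 0 ≤ lam := Real.logb_nonneg (by norm_num) hM1
  let pe : E.M → E.S → ℝ := fun m s => ∑ y, output (E.enc m s) (prodChannel fun _ => WR) y *
    (if dec y s ≠ m then 1 else 0)
  have h1 : ∀ s, lam - 1 - lam * ((Fintype.card E.M : ℝ)⁻¹ * ∑ m, pe m s) ≤
      mutualInfo (uniform E.M) (Channel.comp (fun m => E.enc m s) (prodChannel fun _ => WR)) :=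
    fun s => le_mutualInfo_of_decoder _ fun y => dec y s
  have h2 : (Fintype.card E.S : ℝ)⁻¹ * ∑ s, ((Fintype.card E.M : ℝ)⁻¹ * ∑ m, pe m s) ≤ ε := by
    calc _ = (Fintype.card E.M : ℝ)⁻¹ * ∑ m, ∑ s, 1 / (Fintype.card E.S : ℝ) * pe m s := by
          rw [← Finset.mul_sum, Finset.sum_comm]
          simp_rw [← Finset.mul_sum]
          ring
      _ ≤ (Fintype.card E.M : ℝ)⁻¹ * ∑ _m : E.M, ε :=
          mul_le_mul_of_nonneg_left (Finset.sum_le_sum fun m _ => h m) (by positivity)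
      _ = ε := by
          rw [Finset.sum_const, Finset.card_univ, nsmul_eq_mul, inv_mul_cancel_left₀ hM.ne']
  have h3 := mul_le_mul_of_nonneg_left (Finset.sum_le_sum fun s (_ : s ∈ Finset.univ) => h1 s)
    (inv_pos.2 hS).le
  rw [Finset.sum_sub_distrib, Finset.sum_const, Finset.card_univ, nsmul_eq_mul, mul_sub,
    inv_mul_cancel_left₀ hS.ne', ← Finset.mul_sum] at h3
  have h4 := mul_le_mul_of_nonneg_left h2 hl
  rw [SeededEncoder.info]
  linarith

lemma SeededEncoder.IsSecret.info_le {E : SeededEncoder n X} {Q : Type w} {Z : Type v} [Fintype Z]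
    {W : Q → Channel X Z} {t : Q → ℕ} {ε : ℝ} (h : E.IsSecret W t ε) {w : Fin n → Q}
    (hw : w ∈ stateSequences n t) :
    E.info (fun i => W (w i)) ≤ (2 + Real.logb 2 (Fintype.card E.M)) * (2 * ε) := by
  have hS : (0 : ℝ) < Fintype.card E.S := by exact_mod_cast Fintype.card_pos
  have hM : (0 : ℝ) < Fintype.card E.M := by exact_mod_cast Fintype.card_pos
  have hM1 : (1 : ℝ) ≤ Fintype.card E.M := by exact_mod_cast Fintype.card_pos
  have hl : 0 ≤ Real.logb 2 (Fintype.card E.M) := Real.logb_nonneg (by norm_num) hM1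
  let d : E.M → E.M → E.S → ℝ := fun m m' s =>
    ∑ z, |E.eavesdropper W w m s z - E.eavesdropper W w m' s z|
  have hd : ∀ m m', (Fintype.card E.S : ℝ)⁻¹ * ∑ s, d m m' s ≤ 2 * ε := by
    intro m m'
    have := h w hw m m'
    rw [variationalDistance, Fintype.sum_prod_type] at this
    have e : ∀ s z, |1 / (Fintype.card E.S : ℝ) * E.eavesdropper W w m s z -
        1 / (Fintype.card E.S : ℝ) * E.eavesdropper W w m' s z| = (Fintype.card E.S : ℝ)⁻¹ *
        |E.eavesdropper W w m s z - E.eavesdropper W w m' s z| := by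
      intro s z
      rw [← mul_sub, abs_mul, one_div, abs_of_pos (inv_pos.2 hS)]
    simp only [e, ← Finset.mul_sum] at this
    linarith
  calc _ ≤ (Fintype.card E.S : ℝ)⁻¹ * ∑ s, (2 + Real.logb 2 (Fintype.card E.M)) *
        ((Fintype.card E.M : ℝ)⁻¹ * ∑ m, (Fintype.card E.M : ℝ)⁻¹ * ∑ m', d m m' s) :=
        mul_le_mul_of_nonneg_left (Finset.sum_le_sum fun s _ => mutualInfo_le_of_close _)
          (by positivity)
    _ = (2 + Real.logb 2 (Fintype.card E.M)) * ((Fintype.card E.M : ℝ)⁻¹ * ∑ m,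
        (Fintype.card E.M : ℝ)⁻¹ * ∑ m', (Fintype.card E.S : ℝ)⁻¹ * ∑ s, d m m' s) := by
        simp_rw [← Finset.mul_sum]
        have : ∑ s, ∑ m, ∑ m', d m m' s = ∑ m, ∑ m', ∑ s, d m m' s := by
          rw [Finset.sum_comm]
          exact Finset.sum_congr rfl fun m _ => Finset.sum_comm
        rw [this]
        ring
    _ ≤ (2 + Real.logb 2 (Fintype.card E.M)) * ((Fintype.card E.M : ℝ)⁻¹ * ∑ _m : E.M,
        (Fintype.card E.M : ℝ)⁻¹ * ∑ _m' : E.M, 2 * ε) := by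
        refine mul_le_mul_of_nonneg_left (mul_le_mul_of_nonneg_left
          (Finset.sum_le_sum fun m _ => mul_le_mul_of_nonneg_left
            (Finset.sum_le_sum fun m' _ => hd m m') ?_) ?_) ?_ <;> positivity
    _ = _ := by
        simp only [Finset.sum_const, Finset.card_univ, nsmul_eq_mul]
        field_simp

end Info

/-! ## Random state sequences -/

section States

variable {Q : Type u}

/-- Replacing the factors one at a time by random ones. -/
lemma le_average_of_update_le [Fintype Q] (g : Q → ℝ) (hg : ∀ q, 0 ≤ g q) (hg1 : ∑ q, g q = 1)
    (V : ℝ) {n : ℕ} (J : (Fin n → Option Q) → ℝ)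
    (h : ∀ w i, J (Function.update w i none) ≤
      V + ∑ q, g q * J (Function.update w i (some q))) :
    J (fun _ => none) ≤ n * V + ∑ w : Fin n → Q, (∏ i, g (w i)) * J (fun i => some (w i)) := by
  induction n with
  | zero =>
    simp only [Nat.cast_zero, zero_mul, zero_add, Finset.univ_eq_empty, Finset.prod_empty, one_mul,
      Finset.univ_unique, Finset.sum_singleton]
    exact le_of_eq (congrArg J (Subsingleton.elim _ _))
  | succ n ih =>
    have h1 := ih (fun v => J (Fin.cons none v)) fun w i => by
      simp only [Fin.cons_update]
      exact h _ _
    have hprod : ∑ v : Fin n → Q, ∏ i, g (v i) = 1 := sum_prod_eq_one (fun _ => g) fun _ => hg1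
    have h2 : ∀ v : Fin n → Q, J (Fin.cons none fun i => some (v i)) ≤
        V + ∑ q, g q * J (Fin.cons (some q) fun i => some (v i)) := by
      intro v
      have := h (Fin.cons none fun i => some (v i)) 0
      simpa only [Fin.update_cons_zero] using this
    have e0 : (fun _ : Fin (n + 1) => (none : Option Q)) = Fin.cons none fun _ => none := by
      ext i; cases i using Fin.cases <;> rfl
    have e1 : ∀ (q : Q) (v : Fin n → Q), (fun i => some ((Fin.cons q v : Fin (n + 1) → Q) i)) =
        (Fin.cons (some q) fun i => some (v i) : Fin (n + 1) → Option Q) := by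
      intro q v
      funext i; cases i using Fin.cases <;> rfl
    rw [e0, sum_fin_succ_pi]
    simp only [e1, Fin.prod_univ_succ, Fin.cons_zero, Fin.cons_succ]
    calc _ ≤ _ := h1
      _ ≤ n * V + ∑ v : Fin n → Q, (∏ i, g (v i)) *
          (V + ∑ q, g q * J (Fin.cons (some q) fun i => some (v i))) := by
          gcongr with v _
          · exact Finset.prod_nonneg fun i _ => hg _
          · exact h2 v
      _ = _ := by
          simp_rw [mul_add, Finset.sum_add_distrib]
          rw [← Finset.sum_mul, hprod, Finset.sum_comm]
          simp_rw [Finset.mul_sum]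
          push_cast
          rw [add_mul, add_assoc]
          congr 2
          exact Finset.sum_congr rfl fun v _ => Finset.sum_congr rfl fun q _ => by ring

lemma card_update_eq {n : ℕ} (w : Fin n → Q) (i : Fin n) (a q : Q) :
    Fintype.card {j // Function.update w i a j = q} + (if w i = q then 1 else 0) =
      Fintype.card {j // w j = q} + (if a = q then 1 else 0) := by
  simp_rw [Fintype.card_subtype, Finset.card_filter]
  rw [← Finset.add_sum_erase _ _ (Finset.mem_univ i),
    ← Finset.add_sum_erase _ (fun j => if w j = q then 1 else 0) (Finset.mem_univ i),
    Function.update_self, Finset.sum_congr rfl (g := fun j => if w j = q then 1 else 0)]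
  · ring
  · intro j hj
    rw [Function.update_of_ne (Finset.ne_of_mem_erase hj)]

lemma sum_card_fiber [Fintype Q] {n : ℕ} (w : Fin n → Q) :
    ∑ q, Fintype.card {j // w j = q} = n := by
  simp_rw [Fintype.card_subtype, Finset.card_filter]
  rw [Finset.sum_comm]
  simp

/-- A function that is bounded on the state sequences of type `t` and does not vary much with
single states is bounded in terms of the distance to type `t`. -/
lemma le_add_mul_type_distance [Fintype Q] {n : ℕ} (J : (Fin n → Q) → ℝ) (B L : ℝ) (t : Q → ℕ)
    (ht : ∑ q, t q = n) (hB : ∀ w ∈ stateSequences n t, J w ≤ B)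
    (hL : ∀ w i q, J w ≤ J (Function.update w i q) + L) (w : Fin n → Q) :
    J w ≤ B + L * ((∑ q, (Fintype.card {j // w j = q} - t q) : ℕ) : ℝ) := by
  induction hd : ∑ q, (Fintype.card {j // w j = q} - t q) generalizing w with
  | zero =>
    have hle : ∀ q ∈ Finset.univ, Fintype.card {j // w j = q} ≤ t q := by
      intro q hq
      have := (Finset.sum_eq_zero_iff.1 hd) q hq
      omega
    have hw := (Finset.sum_eq_sum_iff_of_le hle).1 ((sum_card_fiber w).trans ht.symm)
    simpa using hB w fun q => hw q (Finset.mem_univ q)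
  | succ d ih =>
    obtain ⟨q₀, -, hq₀⟩ : ∃ q ∈ Finset.univ, t q < Fintype.card {j // w j = q} := by
      by_contra! hall
      have : ∑ q, (Fintype.card {j // w j = q} - t q) = 0 :=
        Finset.sum_eq_zero fun q hq => Nat.sub_eq_zero_of_le (hall q hq)
      omega
    obtain ⟨q₁, -, hq₁⟩ : ∃ q ∈ Finset.univ, Fintype.card {j // w j = q} < t q := by
      by_contra! hall
      have := Finset.sum_lt_sum hall ⟨q₀, Finset.mem_univ _, hq₀⟩
      rw [sum_card_fiber, ht] at this
      omega
    obtain ⟨⟨i, hi⟩⟩ : Nonempty {j // w j = q₀} := Fintype.card_pos_iff.1 (by omega)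
    have hne : q₁ ≠ q₀ := by rintro rfl; omega
    have hstep : ∀ q, (Fintype.card {j // Function.update w i q₁ j = q} - t q) +
        (if q = q₀ then 1 else 0) = Fintype.card {j // w j = q} - t q := by
      intro q
      have := card_update_eq w i q₁ q
      rw [hi] at this
      by_cases h0 : q = q₀
      · subst h0
        simp only [if_true, if_neg hne] at this ⊢
        omega
      · rw [if_neg (Ne.symm h0)] at this
        rw [if_neg h0]
        by_cases h1 : q₁ = q
        · subst h1
          simp only [if_true] at this
          omega
        · rw [if_neg h1] at this
          omega
    have hsum : ∑ q, (Fintype.card {j // Function.update w i q₁ j = q} - t q) = d := by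
      have := Finset.sum_congr rfl fun q (_ : q ∈ Finset.univ) => hstep q
      rw [Finset.sum_add_distrib, hd] at this
      simpa using this
    have := ih _ hsum
    have := hL w i q₁
    push_cast
    linarith

lemma average_type_distance_le [Fintype Q] {n : ℕ} (hn : 0 < n) (t : Q → ℕ) (ht : ∑ q, t q = n) :
    ∑ w : Fin n → Q, (∏ i, (t (w i) : ℝ) / n) *
      ((∑ q, (Fintype.card {j // w j = q} - t q) : ℕ) : ℝ) ≤ Fintype.card Q * √n := by
  have hn' : (0 : ℝ) < n := by exact_mod_cast hn
  set g : Q → ℝ := fun q => (t q : ℝ) / n with hg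
  have hg0 : ∀ q, 0 ≤ g q := fun q => by positivity
  have hg1 : ∑ q, g q = 1 := by
    rw [← Finset.sum_div, ← Nat.cast_sum, ht, div_self hn'.ne']
  have hgle : ∀ q, g q ≤ 1 := fun q =>
    hg1 ▸ Finset.single_le_sum (fun q _ => hg0 q) (Finset.mem_univ q)
  have hsq : 0 < √(n : ℝ) := Real.sqrt_pos.2 hn'
  have key : ∀ q, ∑ w : Fin n → Q, (∏ i, g (w i)) *
      ((Fintype.card {j // w j = q} - t q : ℕ) : ℝ) ≤ √n := by
    intro q
    let Y : Q → ℝ := fun a => (if a = q then 1 else 0) - g q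
    have hY0 : ∑ a, g a * Y a = 0 := by
      simp_rw [Y, mul_sub, Finset.sum_sub_distrib, ← Finset.sum_mul, hg1]
      simp
    have hY1 : ∀ a, Y a ^ 2 ≤ 1 := by
      intro a
      rw [sq_le_one_iff_abs_le_one, abs_le]
      simp only [Y]
      split_ifs <;> constructor <;> linarith [hg0 q, hgle q]
    have hvar := sum_prod_mul_sq_sum (n := n) (fun _ => g) (fun _ => Y) (fun _ => hg1)
      fun _ => hY0
    have hvar' : ∑ w : Fin n → Q, (∏ i, g (w i)) * (∑ i, Y (w i)) ^ 2 ≤ n := by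
      rw [hvar]
      calc _ ≤ ∑ _i : Fin n, ∑ a, g a * 1 := by
            gcongr with i _ a _
            exact hY1 a
        _ = n := by simp [hg1]
    have hpt : ∀ w : Fin n → Q, ((Fintype.card {j // w j = q} - t q : ℕ) : ℝ) ≤
        2⁻¹ * √n + 2⁻¹ * (√n)⁻¹ * (∑ i, Y (w i)) ^ 2 := by
      intro w
      have e : ∑ i, Y (w i) = (Fintype.card {j // w j = q} : ℝ) - t q := by
        simp only [Y, Finset.sum_sub_distrib, Finset.sum_boole, Finset.sum_const,
          Finset.card_univ, Fintype.card_fin, nsmul_eq_mul, hg, Fintype.card_subtype]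
        field_simp
      have h1 : ((Fintype.card {j // w j = q} - t q : ℕ) : ℝ) ≤ |∑ i, Y (w i)| := by
        rw [e]
        rcases le_total (t q) (Fintype.card {j // w j = q}) with h | h
        · rw [Nat.cast_sub h]; exact le_abs_self _
        · rw [Nat.sub_eq_zero_of_le h, Nat.cast_zero]; exact abs_nonneg _
      have h2 : |∑ i, Y (w i)| ≤ 2⁻¹ * √n + 2⁻¹ * (√n)⁻¹ * (∑ i, Y (w i)) ^ 2 := by
        rw [← sq_abs (∑ i, Y (w i))]
        have h3 := mul_nonneg (inv_pos.2 hsq).le (sq_nonneg (√n - |∑ i, Y (w i)|))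
        have h4 : (√n : ℝ)⁻¹ * (√n - |∑ i, Y (w i)|) ^ 2 =
            √n - 2 * |∑ i, Y (w i)| + (√n)⁻¹ * |∑ i, Y (w i)| ^ 2 := by
          field_simp
          ring
        linarith
      exact h1.trans h2
    calc _ ≤ ∑ w : Fin n → Q, (∏ i, g (w i)) *
          (2⁻¹ * √n + 2⁻¹ * (√n)⁻¹ * (∑ i, Y (w i)) ^ 2) :=
          Finset.sum_le_sum fun w _ => mul_le_mul_of_nonneg_left (hpt w)
            (Finset.prod_nonneg fun i _ => hg0 _)
      _ = 2⁻¹ * √n * (∑ w : Fin n → Q, ∏ i, g (w i)) + 2⁻¹ * (√n)⁻¹ *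
          ∑ w : Fin n → Q, (∏ i, g (w i)) * (∑ i, Y (w i)) ^ 2 := by
          rw [Finset.mul_sum, Finset.mul_sum, ← Finset.sum_add_distrib]
          exact Finset.sum_congr rfl fun w _ => by ring
      _ ≤ 2⁻¹ * √n * 1 + 2⁻¹ * (√n)⁻¹ * n := by
          rw [sum_prod_eq_one (fun _ => g) fun _ => hg1]
          gcongr
      _ = √n := by
          have : (√n : ℝ)⁻¹ * n = √n := by
            rw [inv_mul_eq_iff_eq_mul₀ hsq.ne', Real.mul_self_sqrt hn'.le]
          rw [mul_assoc 2⁻¹ (√n : ℝ)⁻¹, this]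
          ring
  push_cast
  simp_rw [Finset.mul_sum]
  rw [Finset.sum_comm]
  refine (Finset.sum_le_sum fun q _ => ?_).trans_eq
    (by rw [Finset.sum_const, Finset.card_univ, nsmul_eq_mul])
  exact key q

end States

/-! ## The converse -/

lemma mutualInfo_const {M : Type u} [Fintype M] {Z : Type v} [Fintype Z] (P : Distr M)
    (D : Distr Z) : mutualInfo P (fun _ => D) = 0 := by
  have h : ∀ z, output P (fun _ => D) z = D z := fun z => by
    rw [output_apply, ← Finset.sum_mul, distr_sum, one_mul]
  rw [mutualInfo_eq_sum_sum]
  simp [h]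

section Converse

variable {X : Type} {Y : Type u} [Fintype Y] {Q : Type v} {Z : Type w} [Fintype Z]

/-- The receiver's channel and the eavesdropper's channels, with a common output alphabet. -/
def jointChannel (WR : Channel X Y) (W : Q → Channel X Z) : Option Q → Channel X (Y ⊕ Z)
  | none => fun x => ⟨Sum.elim (WR x) 0, by
      rintro (y | z)
      exacts [distr_nonneg _ _, le_rfl], by
      simp [Fintype.sum_sum_type]⟩
  | some q => fun x => ⟨Sum.elim 0 (W q x), by
      rintro (y | z)
      exacts [le_rfl, distr_nonneg _ _], by
      simp [Fintype.sum_sum_type]⟩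

variable (WR : Channel X Y) (W : Q → Channel X Z)

lemma jointChannel_none_of_notMem (x : X) (a : Y ⊕ Z) (h : a ∉ Set.range Sum.inl) :
    jointChannel WR W none x a = 0 := by
  rcases a with y | z
  exacts [absurd ⟨y, rfl⟩ h, rfl]

lemma jointChannel_some_of_notMem (q : Q) (x : X) (a : Y ⊕ Z) (h : a ∉ Set.range Sum.inr) :
    jointChannel WR W (some q) x a = 0 := by
  rcases a with y | z
  exacts [rfl, absurd ⟨z, rfl⟩ h]

variable [Fintype X]

lemma mutualInfo_comp_jointChannel_none {M : Type*} [Fintype M] (P : Distr M) (T : Channel M X) :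
    mutualInfo P (T.comp (jointChannel WR W none)) = mutualInfo P (T.comp WR) := by
  refine (mutualInfo_eq_of_injective P _ _ Sum.inl Sum.inl_injective (fun m z => rfl)
    fun m a ha => ?_).symm
  rw [Channel.comp, output_apply]
  exact Finset.sum_eq_zero fun x _ => by rw [jointChannel_none_of_notMem WR W x a ha, mul_zero]

lemma mutualInfo_comp_jointChannel_some {M : Type*} [Fintype M] (P : Distr M) (T : Channel M X)
    (q : Q) :
    mutualInfo P (T.comp (jointChannel WR W (some q))) = mutualInfo P (T.comp (W q)) := by
  refine (mutualInfo_eq_of_injective P _ _ Sum.inr Sum.inr_injective (fun m z => rfl)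
    fun m a ha => ?_).symm
  rw [Channel.comp, output_apply]
  exact Finset.sum_eq_zero fun x _ => by rw [jointChannel_some_of_notMem WR W q x a ha, mul_zero]

variable [Fintype Q]

lemma SeededEncoder.logb_card_le {n : ℕ} (hn : 0 < n) (E : SeededEncoder n X)
    (dec : (Fin n → Y) → E.S → E.M) (t : Q → ℕ) (ht : ∑ q, t q = n) (ε : ℝ)
    (hc : E.IsCorrect dec WR ε) (hs : E.IsSecret W t ε) (V : ℝ)
    (hV : ∀ (P : Distr E.M) (T : Channel E.M X), mutualInfo P (T.comp WR) -
      ∑ q, (t q : ℝ) / n * mutualInfo P (T.comp (W q)) ≤ V) :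
    (1 - ε) * Real.logb 2 (Fintype.card E.M) - 1 ≤
      n * V + ((2 + Real.logb 2 (Fintype.card E.M)) * (2 * ε) +
        Real.logb 2 (Fintype.card (Y ⊕ Z)) * (Fintype.card Q * √n)) := by
  have hn' : (0 : ℝ) < n := by exact_mod_cast hn
  set g : Q → ℝ := fun q => (t q : ℝ) / n with hg
  have hg0 : ∀ q, 0 ≤ g q := fun q => by positivity
  have hg1 : ∑ q, g q = 1 := by
    rw [← Finset.sum_div, ← Nat.cast_sum, ht, div_self hn'.ne']
  set K := jointChannel WR W with hK
  set L := Real.logb 2 (Fintype.card (Y ⊕ Z)) with hL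
  let J : (Fin n → Option Q) → ℝ := fun w => E.info fun i => K (w i)
  have hJ : ∀ w i a, J (Function.update w i a) =
      E.info (Function.update (fun i => K (w i)) i (K a)) := fun w i a =>
    congrArg E.info (Function.comp_update K w i a)
  have hL0 : 0 ≤ L := by
    rcases Nat.eq_zero_or_pos (Fintype.card (Y ⊕ Z)) with h | h
    · rw [hL, h]; simp
    · exact Real.logb_nonneg (by norm_num) (by exact_mod_cast h)
  have h1 : J (fun _ => none) ≤ n * V +
      ∑ w : Fin n → Q, (∏ i, g (w i)) * J (fun i => some (w i)) := by
    refine le_average_of_update_le g hg0 hg1 V J fun w i => ?_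
    have := E.sum_mul_info_update_le K (fun a => a.elim 1 fun q => -g q)
      (by simp [Fintype.sum_option, hg1]) V (fun P T => by
        simp only [Fintype.sum_option, Option.elim_none, Option.elim_some, hK,
          mutualInfo_comp_jointChannel_none, mutualInfo_comp_jointChannel_some, one_mul, neg_mul,
          Finset.sum_neg_distrib]
        exact hV P T) (fun i => K (w i)) i
    simp only [Fintype.sum_option, Option.elim_none, Option.elim_some, one_mul, neg_mul,
      Finset.sum_neg_distrib] at this
    simp only [hJ]
    linarith
  have h2 : (1 - ε) * Real.logb 2 (Fintype.card E.M) - 1 ≤ J fun _ => none := by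
    refine (E.le_info_of_isCorrect dec WR ε hc).trans_eq ?_
    exact E.info_eq_of_injective _ _ Sum.inl Sum.inl_injective (fun i x z => rfl)
      fun i x a ha => jointChannel_none_of_notMem WR W x a ha
  set B := (2 + Real.logb 2 (Fintype.card E.M)) * (2 * ε) with hB
  have h3 : ∀ w : Fin n → Q, J (fun i => some (w i)) ≤
      B + L * ((∑ q, (Fintype.card {j // w j = q} - t q) : ℕ) : ℝ) := by
    refine le_add_mul_type_distance (fun w : Fin n → Q => J fun i => some (w i)) B L t ht
      (fun w hw => ?_) fun w i q => ?_
    · refine le_trans (le_of_eq ?_) (hs.info_le hw)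
      exact (E.info_eq_of_injective _ _ Sum.inr Sum.inr_injective (fun i x z => rfl)
        fun i x a ha => jointChannel_some_of_notMem WR W (w i) x a ha).symm
    · have e : (fun j => some (Function.update w i q j)) =
          Function.update (fun j => some (w j)) i (some q) := Function.comp_update some w i q
      have e' : J (fun j => some (w j)) =
          J (Function.update (fun j => some (w j)) i (some (w i))) := by
        rw [Function.update_eq_self i fun j => some (w j)]
      rw [e, e', hJ, hJ]
      exact E.info_update_le _ _ _ _
  calc _ ≤ _ := h2
    _ ≤ _ := h1
    _ ≤ n * V + ∑ w : Fin n → Q, (∏ i, g (w i)) *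
        (B + L * ((∑ q, (Fintype.card {j // w j = q} - t q) : ℕ) : ℝ)) := by
        gcongr with w _
        exact h3 w
    _ = n * V + (B * (∑ w : Fin n → Q, ∏ i, g (w i)) + L * ∑ w : Fin n → Q, (∏ i, g (w i)) *
        ((∑ q, (Fintype.card {j // w j = q} - t q) : ℕ) : ℝ)) := by
        rw [Finset.mul_sum, Finset.mul_sum, ← Finset.sum_add_distrib]
        congr 1
        exact Finset.sum_congr rfl fun w _ => by ring
    _ ≤ n * V + (B * 1 + L * (Fintype.card Q * √n)) := by
        rw [sum_prod_eq_one (fun _ => g) fun _ => hg1]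
        gcongr
        exact average_type_distance_le hn t ht
    _ = _ := by rw [mul_one]

/-- Upper bound on the achievable secrecy rates. -/
theorem IsAchievableSecrecyRate.le {f : Q → ℝ} {n : ℕ → ℕ} {t : ℕ → Q → ℕ}
    (hsum : ∀ j, ∑ q, t j q = n j) (hn : Tendsto n atTop atTop)
    (ht : ∀ q, Tendsto (fun j => (t j q : ℝ) / n j) atTop (𝓝 (f q))) {V : ℝ}
    (hV : ∀ (M : Type) [Fintype M] (P : Distr M) (T : Channel M X), mutualInfo P (T.comp WR) -
      ∑ q, f q * mutualInfo P (T.comp (W q)) ≤ V) {r : ℝ}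
    (hr : IsAchievableSecrecyRate WR W n t r) : r ≤ V := by
  obtain ⟨E, dec, ε, hε, hE, hrate⟩ := hr
  refine le_of_forall_pos_le_add fun δ hδ => ?_
  let l : ℝ := Real.logb 2 (Fintype.card Z)
  let L : ℝ := Real.logb 2 (Fintype.card (Y ⊕ Z))
  let b : ℕ → ℝ := fun j => V + ∑ q, |f q - (t j q : ℝ) / n j| * l + (1 + 4 * ε j) * (n j : ℝ)⁻¹ +
    L * Fintype.card Q * √((n j : ℝ)⁻¹)
  have hinv : Tendsto (fun j => (n j : ℝ)⁻¹) atTop (𝓝 0) :=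
    tendsto_inv_atTop_nhds_zero_nat.comp hn
  have hb : Tendsto b atTop (𝓝 (V + ∑ q : Q, |f q - f q| * l + (1 + 4 * 0) * 0 +
      L * Fintype.card Q * √0)) := by
    refine ((tendsto_const_nhds.add (tendsto_finsetSum _ fun q _ => ?_)).add
      (((hε.const_mul 4).const_add 1).mul hinv)).add (hinv.sqrt.const_mul _)
    exact ((tendsto_const_nhds.sub (ht q)).abs).mul_const l
  have ha : Tendsto (fun j => (r - δ) * (1 - 3 * ε j)) atTop (𝓝 ((r - δ) * (1 - 3 * 0))) :=
    ((hε.const_mul 3).const_sub 1).const_mul _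
  simp only [sub_self, abs_zero, zero_mul, Finset.sum_const_zero, mul_zero, add_zero,
    Real.sqrt_zero, sub_zero, mul_one] at hb ha
  have hle : r - δ ≤ V := by
    refine le_of_tendsto_of_tendsto ha hb ?_
    filter_upwards [hrate δ hδ, hn.eventually_gt_atTop 0,
      hε.eventually_le_const (show (0 : ℝ) < 1 / 3 by norm_num)] with j h1 h2 h3
    have hn' : (0 : ℝ) < n j := by exact_mod_cast h2
    have hbound := (E j).logb_card_le WR W h2 (dec j) (t j) (hsum j) (ε j) (hE j).1 (hE j).2
      (V + ∑ q, |f q - (t j q : ℝ) / n j| * l) fun P T => by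
        have h4 := hV _ P T
        have h5 : ∑ q, f q * mutualInfo P (T.comp (W q)) -
            ∑ q, (t j q : ℝ) / n j * mutualInfo P (T.comp (W q)) ≤
            ∑ q, |f q - (t j q : ℝ) / n j| * l := by
          rw [← Finset.sum_sub_distrib]
          refine Finset.sum_le_sum fun q _ => ?_
          rw [← sub_mul]
          exact (mul_le_mul_of_nonneg_right (le_abs_self _) (mutualInfo_nonneg _ _)).trans
            (mul_le_mul_of_nonneg_left (mutualInfo_le _ _) (abs_nonneg _))
        linarith
    set lam := Real.logb 2 (Fintype.card (E j).M)
    have hb1 : lam / n j * (1 - 3 * ε j) ≤ b j := by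
      have hs : √(n j : ℝ) = n j * √((n j : ℝ)⁻¹) := by
        rw [Real.sqrt_inv, ← div_eq_mul_inv, Real.div_sqrt]
      rw [hs] at hbound
      rw [div_mul_eq_mul_div, div_le_iff₀ hn']
      have : b j * n j = n j * (V + ∑ q, |f q - (t j q : ℝ) / n j| * l) + (1 + 4 * ε j) +
          L * (Fintype.card Q * (n j * √((n j : ℝ)⁻¹))) := by
        simp only [b, add_mul, mul_assoc, inv_mul_cancel₀ hn'.ne']
        ring
      rw [this]
      linarith
    refine le_trans ?_ hb1
    exact mul_le_mul_of_nonneg_right h1 (by linarith)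
  linarith

end Converse

end

end Wiretap

theorem mainTheorem4 {p : ℕ} [Fact p.Prime] {Q Z : Type*} [Fintype Q] [Fintype Z]
    (W : Q → Channel (ZMod p) Z) (hW : ∀ q, IsSymmetric (W q)) :
    -- every message length below the bound is secure
    (∀ δ > (0 : ℝ), ∀ ε > (0 : ℝ), ∃ n₀ : ℕ, ∀ n ≥ n₀, ∀ t : Q → ℕ, ∑ q, t q = n →
      ∀ (k : ℕ) (ecc : (Fin k → ZMod p) →ₗ[ZMod p] (Fin n → ZMod p)), Function.Injective ecc →
      ∀ H : InvertibleHash (Fin k → ZMod p),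
        Real.logb 2 (Fintype.card H.M) ≤ Real.logb 2 (Fintype.card (Fin k → ZMod p))
          - n * ∑ q, (t q : ℝ) / n * uniformInfo (W q) - n * δ →
        (protocolEncoder H ecc).IsSecretForRandomMessages W t ε ∧
        (H.IsLinear (ZMod p) → (p ≤ 3 ∨ ∀ q, IsTranslationCovariant (W q)) →
          (protocolEncoder H ecc).IsSecret W t ε)) ∧
    -- the bound is reached, and so is the secrecy capacity
    (∀ (f : Q → ℝ) (n : ℕ → ℕ) (t : ℕ → Q → ℕ), (∀ j, ∑ q, t j q = n j) →
      Tendsto n atTop atTop → (∀ q, Tendsto (fun j => (t j q : ℝ) / n j) atTop (𝓝 (f q))) →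
      ∀ (k : ℕ → ℕ) (ecc : ∀ j, (Fin (k j) → ZMod p) →ₗ[ZMod p] (Fin (n j) → ZMod p)),
      (∀ j, Function.Injective (ecc j)) →
      (∃ (H : ∀ j, InvertibleHash (Fin (k j) → ZMod p)) (ε : ℕ → ℝ),
        Tendsto ε atTop (𝓝 0) ∧
        (∀ j, (protocolEncoder (H j) (ecc j)).IsSecret W (t j) (ε j)) ∧
        Tendsto (fun j => (Real.logb 2 (Fintype.card (H j).M)
          - max 0 (Real.logb 2 (Fintype.card (Fin (k j) → ZMod p))
            - n j * ∑ q, f q * uniformInfo (W q))) / n j) atTop (𝓝 0)) ∧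
      (∀ {Y : Type} [Fintype Y] (WR : Channel (ZMod p) Y)
        (dec : ∀ j, (Fin (n j) → Y) → (Fin (k j) → ZMod p)),
        Tendsto (fun j => codeError (ecc j) (dec j) WR) atTop (𝓝 0) →
        Tendsto (fun j => Real.logb 2 (Fintype.card (Fin (k j) → ZMod p)) / n j) atTop
          (𝓝 (shannonCapacity WR)) →
        (∀ (a : ℕ) (P : Distr (Fin a)) (T : Channel (Fin a) (ZMod p)),
          mutualInfo P (T.comp WR) - ∑ q, f q * mutualInfo P (T.comp (W q)) ≤
            uniformInfo WR - ∑ q, f q * uniformInfo (W q)) →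
        (∃ (H : ∀ j, InvertibleHash (Fin (k j) → ZMod p)) (ε : ℕ → ℝ),
          Tendsto ε atTop (𝓝 0) ∧
          (∀ j, (protocolEncoder (H j) (ecc j)).IsCorrect
              (protocolDecoder (H j) (ecc j) (dec j)) WR (ε j) ∧
            (protocolEncoder (H j) (ecc j)).IsSecret W (t j) (ε j)) ∧
          Tendsto (fun j => Real.logb 2 (Fintype.card (H j).M) / n j) atTop
            (𝓝 (shannonCapacity WR - ∑ q, f q * uniformInfo (W q)))) ∧
        IsGreatest {r | IsAchievableSecrecyRate WR W n t r}
          (shannonCapacity WR - ∑ q, f q * uniformInfo (W q)))) := by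
  refine ⟨fun δ hδ ε hε => ?_, fun f n t hsum hn ht k ecc _ => ?_⟩
  · obtain ⟨n₀, h₀⟩ := exists_average_hashDistance_le W hW δ hδ ε hε
    refine ⟨n₀, fun n hn t _ k ecc _ H hM => ⟨?_, fun hH hp => ?_⟩⟩
    · exact isSecretForRandomMessages_protocolEncoder H ecc W t ε fun w hw =>
        h₀ n hn t w hw _ ecc H hM
    · have hcov : ∀ q, IsTranslationCovariant (W q) :=
        hp.elim (fun hp q => (hW q).isTranslationCovariant hp) id
      exact isSecret_protocolEncoder H ecc W t ε fun w hw =>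
        hashDistance_le_of_const H _
          (hashDistance_eq_of_isLinear ecc H hH (fun i => W (w i)) fun i => hcov _) ε
          (h₀ n hn t w hw _ ecc H hM)
  · obtain ⟨l, ε, hε, hsec, hrate⟩ :=
      exists_permHash_isSecret W hW f n t hn ht k fun j => ecc j
    refine ⟨⟨fun j => permHash (codeSplitting p (k j) (l j)), ε, hε, hsec, hrate⟩,
      fun {Y} _ WR dec herr hcap hopt => ?_⟩
    have hopt' : ∀ (M : Type) [Fintype M] (P : Distr M) (T : Channel M (ZMod p)),
        mutualInfo P (T.comp WR) - ∑ q, f q * mutualInfo P (T.comp (W q)) ≤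
          uniformInfo WR - ∑ q, f q * uniformInfo (W q) := by
      intro M _ P T
      let e := (Fintype.equivFin M).symm
      let P' : Distr (Fin (Fintype.card M)) := ⟨fun a => P (e a), fun a => distr_nonneg _ _,
        (Equiv.sum_comp e fun m => P m).trans (distr_sum P)⟩
      have h := hopt _ P' fun a => T (e a)
      have h1 : mutualInfo P' (Channel.comp (fun a => T (e a)) WR) = mutualInfo P (T.comp WR) :=
        mutualInfo_eq_of_equiv e P (T.comp WR) P' fun a => rfl
      have h2 : ∀ q, mutualInfo P' (Channel.comp (fun a => T (e a)) (W q)) =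
          mutualInfo P (T.comp (W q)) := fun q =>
        mutualInfo_eq_of_equiv e P (T.comp (W q)) P' fun a => rfl
      simpa only [h1, h2] using h
    have hcapge := uniformInfo_le_shannonCapacity WR
    have hnonneg : 0 ≤ shannonCapacity WR - ∑ q, f q * uniformInfo (W q) := by
      have h := hopt' (Fin 1) (uniform (Fin 1)) fun _ => uniform (ZMod p)
      have hu : ∀ K : Channel (ZMod p) Y, mutualInfo (uniform (Fin 1))
          (Channel.comp (fun _ : Fin 1 => uniform (ZMod p)) K) = 0 := fun K =>
        mutualInfo_const _ (output (uniform (ZMod p)) K)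
      have hq : ∀ K : Channel (ZMod p) Z, mutualInfo (uniform (Fin 1))
          (Channel.comp (fun _ : Fin 1 => uniform (ZMod p)) K) = 0 := fun K =>
        mutualInfo_const _ (output (uniform (ZMod p)) K)
      simp only [hu, hq, mul_zero, Finset.sum_const_zero, sub_zero] at h
      linarith
    have hrate' : Tendsto (fun j => Real.logb 2 (Fintype.card
        (permHash (codeSplitting p (k j) (l j))).M) / n j) atTop
        (𝓝 (shannonCapacity WR - ∑ q, f q * uniformInfo (W q))) := by
      have h1 := (tendsto_const_nhds (x := (0 : ℝ)) (f := atTop)).max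
        (hcap.sub_const (∑ q, f q * uniformInfo (W q)))
      rw [max_eq_right hnonneg] at h1
      have h2 := hrate.add h1
      rw [zero_add] at h2
      refine h2.congr' ?_
      filter_upwards [hn.eventually_gt_atTop 0] with j hj
      have hj' : (0 : ℝ) < n j := by exact_mod_cast hj
      have : max 0 (Real.logb 2 (Fintype.card (Fin (k j) → ZMod p)) / n j -
          ∑ q, f q * uniformInfo (W q)) = max 0 (Real.logb 2 (Fintype.card (Fin (k j) → ZMod p))
            - n j * ∑ q, f q * uniformInfo (W q)) / n j := by
        rw [← max_div_div_right hj'.le, zero_div, sub_div, mul_div_cancel_left₀ _ hj'.ne']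
      rw [this, ← add_div, sub_add_cancel]
    let ε' : ℕ → ℝ := fun j => max (codeError (ecc j) (dec j) WR) (ε j)
    have hε' : Tendsto ε' atTop (𝓝 0) := by simpa using herr.max hε
    have hboth : ∀ j, (protocolEncoder (permHash (codeSplitting p (k j) (l j)))
          (ecc j)).IsCorrect (protocolDecoder (permHash (codeSplitting p (k j) (l j))) (ecc j)
            (dec j)) WR (ε' j) ∧
        (protocolEncoder (permHash (codeSplitting p (k j) (l j))) (ecc j)).IsSecret W (t j)
          (ε' j) := fun j =>
      ⟨fun m => (permHash_isCorrect _ (ecc j) (dec j) WR m).trans (le_max_left _ _),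
        (hsec j).mono (le_max_right _ _)⟩
    refine ⟨⟨_, ε', hε', hboth, hrate'⟩, ⟨_, _, ε', hε', hboth, fun δ hδ => ?_⟩, fun r hr => ?_⟩
    · exact hrate'.eventually_const_le (by linarith)
    · exact (hr.le WR W hsum hn ht hopt').trans (sub_le_sub_right hcapge _)
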